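/- Let $\mathbb D$ be the open unit disk of $\mathbb C$ and $\widehat{\mathbb C}=\mathbb C\cup\{\infty\}$. A self-map of $\mathbb D$ is a holomorphic function $f:\mathbb D\to\mathbb C$ with $f(\mathbb D)\subset\mathbb D$; it is an automorphism if it maps $\mathbb D$ bijectively onto $\mathbb D$. A linear fractional transformation (LFT) is a map $z\mapsto (az+b)/(cz+d)$ with $a,b,c,d\in\mathbb C$, $ad-bc\ne0$; an LFT is also regarded as a bijection of $\widehat{\mathbb C}$, and $\mathrm{Fix}(h)\subset\widehat{\mathbb C}$ denotes the set of fixed points of that bijection. A self-map $f\neq \mathrm{id}_{\mathbb D}$ is called elliptic if it has a fixed point in $\mathbb D$. Otherwise its iterates converge, uniformly on compact subsets of $\mathbb D$, to a point $p$ with $|p|=1$ (the Denjoy-Wolff point of $f$), the angular derivative $f'(p)$ at $p$ exists and $0<f'(p)\le 1$; then $f$ is called hyperbolic if $f'(p)<1$ and parabolic if $f'(p)=1$. (Here $f'(p)$ is the non-tangential limit of $(f(z)-q)/(z-p)$ as $z\to p$, where $q$, $|q|=1$, is the non-tangential limit of $f$ at $p$.) The dynamic type of $f$ is which of these three classes it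 belongs to. Theorem. Let $\varphi$ be a self-map of $\mathbb D$ that is an LFT and is none of the following: the identity, an elliptic automorphism, a parabolic automorphism. Let $f$ be a self-map of $\mathbb D$ that is neither constant nor the identity. Then $f\circ\varphi=\varphi\circ f$ on $\mathbb D$ if and only if $f$ is an LFT and $\mathrm{Fix}(f)=\mathrm{Fix}(\varphi)$. Moreover, if these equivalent conditions hold, then $f$ and $\varphi$ have the same dynamic type. -/

import Mathlib

namespace DiskMap

/-- The open unit disk of the complex plane. -/
abbrev disk : Set ℂ := Metric.ball (0 : ℂ) 1

/-- A self-map of the unit disk: holomorphic on the disk, with values in the disk.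
The values of `f` outside the disk play no role anywhere below. -/
structure IsSelfMap (f : ℂ → ℂ) : Prop where
  differentiableOn : DifferentiableOn ℂ f disk
  mapsTo : Set.MapsTo f disk disk

/-- `f` is the identity map of the disk. -/
def IsIdentity (f : ℂ → ℂ) : Prop := ∀ z ∈ disk, f z = z

/-- `f` is constant on the disk. -/
def IsConstant (f : ℂ → ℂ) : Prop := ∃ c : ℂ, ∀ z ∈ disk, f z = c

/-- `f` is a bijection of the disk onto itself. A self-map of the disk with this property is an
automorphism of the disk, its inverse being automatically holomorphic. -/
def IsAutomorphism (f : ℂ → ℂ) : Prop := Set.BijOn f disk disk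

/-- The two maps commute as maps of the disk. -/
def Commutes (f φ : ℂ → ℂ) : Prop := ∀ z ∈ disk, f (φ z) = φ (f z)

/-- On the disk, `f` is the linear fractional transformation `z ↦ (a z + b) / (c z + d)` of the
Riemann sphere `ℂ ∪ {∞}` given by the invertible matrix `g = (a, b; c, d)`. -/
def IsGivenBy (f : ℂ → ℂ) (g : GL (Fin 2) ℂ) : Prop :=
  ∀ z ∈ disk, ((f z : ℂ) : OnePoint ℂ) = g • ((z : ℂ) : OnePoint ℂ)

/-- `f` is (on the disk) a linear fractional transformation. -/
def IsLFT (f : ℂ → ℂ) : Prop := ∃ g : GL (Fin 2) ℂ, IsGivenBy f g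

/-- The set of fixed points in the Riemann sphere of a linear fractional map `f` of the disk,
seen as a bijection of the sphere. It does not depend on the matrix that gives `f`, see
`sphereFix_eq`. -/
def sphereFix (f : ℂ → ℂ) : Set (OnePoint ℂ) :=
  {w | ∃ g : GL (Fin 2) ℂ, IsGivenBy f g ∧ g • w = w}

/-- The non-tangential approach region (Stolz region) of aperture `M` at a point `p` of the unit
circle. -/
def stolz (p : ℂ) (M : ℝ) : Set ℂ := {z | ‖z‖ < 1 ∧ ‖p - z‖ < M * (1 - ‖z‖)}

/-- `F` has the angular (non-tangential) limit `l` at the point `p` of the unit circle. -/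
def HasAngularLimit (F : ℂ → ℂ) (p l : ℂ) : Prop :=
  ∀ M : ℝ, Filter.Tendsto F (nhdsWithin p (stolz p M)) (nhds l)

/-- `f` has the (finite) angular derivative `m` at the point `p` of the unit circle: the angular
limit `q` of `f` at `p` exists and lies on the unit circle, and `(f z - q) / (z - p)` has the
angular limit `m` at `p`. -/
def HasAngularDeriv (f : ℂ → ℂ) (p m : ℂ) : Prop :=
  ∃ q : ℂ, ‖q‖ = 1 ∧ HasAngularLimit f p q ∧
    HasAngularLimit (fun z => (f z - q) / (z - p)) p m

/-- `p` is a Denjoy-Wolff point of `f` on the unit circle: `f` has no fixed point in the disk and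
its iterates converge to `p` locally uniformly in the disk. -/
def IsBoundaryDenjoyWolffPoint (f : ℂ → ℂ) (p : ℂ) : Prop :=
  (∀ z ∈ disk, f z ≠ z) ∧ ‖p‖ = 1 ∧
    TendstoLocallyUniformlyOn (fun (n : ℕ) (z : ℂ) => f^[n] z) (fun _ => p) Filter.atTop disk

/-- A non-identity self-map of the disk is elliptic if it has a fixed point inside the disk. -/
def IsElliptic (f : ℂ → ℂ) : Prop := ¬ IsIdentity f ∧ ∃ z ∈ disk, f z = z

/-- Hyperbolic: the Denjoy-Wolff point `p` is on the unit circle and `f'(p) < 1`. -/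
def IsHyperbolic (f : ℂ → ℂ) : Prop :=
  ∃ p : ℂ, IsBoundaryDenjoyWolffPoint f p ∧ ∃ m : ℝ, HasAngularDeriv f p (m : ℂ) ∧ m < 1

/-- Parabolic: the Denjoy-Wolff point `p` is on the unit circle and `f'(p) = 1`. -/
def IsParabolic (f : ℂ → ℂ) : Prop :=
  ∃ p : ℂ, IsBoundaryDenjoyWolffPoint f p ∧ HasAngularDeriv f p 1

/-- The three dynamic types of non-identity self-maps of the disk. -/
inductive DynamicType
  | elliptic
  | hyperbolic
  | parabolic

/-- `f` is of the given dynamic type. -/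
def HasType (f : ℂ → ℂ) : DynamicType → Prop
  | .elliptic => IsElliptic f
  | .hyperbolic => IsHyperbolic f
  | .parabolic => IsParabolic f

/-- The fixed-point set is that of any matrix giving the map. -/
theorem sphereFix_eq {f : ℂ → ℂ} {g : GL (Fin 2) ℂ} (hg : IsGivenBy f g) :
    sphereFix f = {w | g • w = w} := by
  have key : ∀ g : GL (Fin 2) ℂ, IsGivenBy f g → ∀ z ∈ disk,
      g 1 0 * z + g 1 1 ≠ 0 ∧ f z * (g 1 0 * z + g 1 1) = g 0 0 * z + g 0 1 := by
    intro g hg z hz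
    have h := hg z hz
    rw [OnePoint.smul_some_eq_ite] at h
    split_ifs at h with h0
    · exact absurd h (OnePoint.coe_ne_infty _)
    · refine ⟨h0, ?_⟩
      rw [OnePoint.coe_eq_coe] at h
      rw [h, div_mul_cancel₀ _ h0]
  have incl : ∀ g k : GL (Fin 2) ℂ, IsGivenBy f g → IsGivenBy f k →
      ∀ w : OnePoint ℂ, g • w = w → k • w = w := by
    intro g k hg hk
    have cross : ∀ z ∈ disk, (g 0 0 * z + g 0 1) * (k 1 0 * z + k 1 1)
        = (k 0 0 * z + k 0 1) * (g 1 0 * z + g 1 1) := by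
      intro z hz
      rw [← (key g hg z hz).2, ← (key k hk z hz).2]
      ring
    have e0 := cross 0 (by simp)
    have e1 := cross (1 / 2) (by simp; norm_num)
    have e2 := cross (-(1 / 2)) (by simp; norm_num)
    have hgd : g 0 0 * g 1 1 - g 0 1 * g 1 0 ≠ 0 := by
      rw [← Matrix.det_fin_two]; exact g.det_ne_zero
    have gd : g 1 1 ≠ 0 := by simpa using (key g hg 0 (by simp)).1
    have kd : k 1 1 ≠ 0 := by simpa using (key k hk 0 (by simp)).1
    have hac : g 0 0 * k 1 0 = k 0 0 * g 1 0 := by linear_combination 2 * e1 + 2 * e2 - 4 * e0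
    have hbd : g 0 1 * k 1 1 = k 0 1 * g 1 1 := by linear_combination e0
    have hm : g 0 0 * k 1 1 + g 0 1 * k 1 0 = k 0 0 * g 1 1 + k 0 1 * g 1 0 := by
      linear_combination e1 - e2
    -- the matrix `k` is `k 1 1 / g 1 1` times `g`
    have hc : k 1 0 * g 1 1 = k 1 1 * g 1 0 := by
      have : (k 1 0 * g 1 1 - k 1 1 * g 1 0) * (g 0 0 * g 1 1 - g 0 1 * g 1 0) = 0 := by
        linear_combination (g 1 1) ^ 2 * hac - g 1 1 * g 1 0 * hm + (g 1 0) ^ 2 * hbd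
      exact sub_eq_zero.mp ((mul_eq_zero.mp this).resolve_right hgd)
    have ha : k 0 0 * g 1 1 = k 1 1 * g 0 0 := by
      have : (k 0 0 * g 1 1 - k 1 1 * g 0 0) * g 1 1 = 0 := by
        linear_combination g 0 1 * hc - g 1 1 * hm + g 1 0 * hbd
      exact sub_eq_zero.mp ((mul_eq_zero.mp this).resolve_right gd)
    intro w hw
    cases w with
    | infty =>
      rw [OnePoint.smul_infty_eq_self_iff] at hw ⊢
      rw [hw, mul_zero] at hc
      exact (mul_eq_zero.mp hc).resolve_right gd
    | coe w =>
      rw [OnePoint.smul_some_eq_ite] at hw ⊢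
      split_ifs at hw with h0
      · exact absurd hw (OnePoint.infty_ne_coe _)
      rw [OnePoint.coe_eq_coe, div_eq_iff h0] at hw
      have hk0 : k 1 0 * w + k 1 1 ≠ 0 := by
        intro h
        apply mul_ne_zero kd h0
        linear_combination g 1 1 * h - w * hc
      rw [if_neg hk0, OnePoint.coe_eq_coe, div_eq_iff hk0]
      apply mul_right_cancel₀ gd
      linear_combination w * ha - hbd + k 1 1 * hw - w * w * hc
  ext w
  exact ⟨fun ⟨k, hk, hw⟩ => incl k g hk hg w hw, fun hw => ⟨g, hg, hw⟩⟩

end DiskMap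

namespace DiskMap

open scoped Topology ComplexConjugate
open Filter

/-! Invertible matrices with the same fixed points on the sphere have proportional fixed-point
quadratics, and this proportionality is exactly the vanishing of their commutator; this gives the
"if" direction. For the converse, `φ` is put in a normal form and the commuting map `f` is shown to
have the same form.

If `φ` fixes a point of the disk, an involution moves that point to `0`. As `φ` is not an
automorphism, Schwarz's lemma makes `0` attracting, and `σ z = z / (1 - β * z)` turns `φ` into
multiplication by `φ'(0)`. The quotient `σ (f z) / σ z` is then invariant under `φ`; orbits near `0`
tend to `0`, so it is constant there and `f` is linear in the same coordinate
(`eventually_linear_of_commutes`). The identity theorem carries this to the whole disk.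

Otherwise `φ` fixes a point of the circle (`exists_boundary_fixed_point`), and a Cayley transform
makes it `A w = l * w + b` on the right half-plane, with `l ≥ 1` if the attracting point is chosen.
Read in this coordinate, `f` becomes a map `F` that extends as `A⁻ⁿ ∘ F ∘ Aⁿ` to all backward images
of the half-plane (`exists_extension`). If `l = 1`, excluding parabolic automorphisms gives `0 <
b.re`; the extension is entire, and Liouville's theorem makes it a translation. If `l > 1`, the
extension lives on a half-plane whose edge contains the finite fixed point of `A`, and equality in
Schwarz's lemma makes it a dilation about that point.

The dynamic type can be read from the fixed points: elliptic if one lies in the disk, otherwise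
parabolic or hyperbolic according as the sphere contains one or two. -/

theorem zero_mem_disk : (0 : ℂ) ∈ disk := by simp

theorem mem_disk_iff {z : ℂ} : z ∈ disk ↔ ‖z‖ < 1 := by simp [disk]

/-! ### Matrices on the sphere: equal fixed points imply commutation -/

/-- The linear fractional transformation of the sphere with the given coefficients. -/
noncomputable def mobius (a b c d : ℂ) (h : a * d - b * c ≠ 0) : GL (Fin 2) ℂ :=
  Matrix.GeneralLinearGroup.mkOfDetNeZero !![a, b; c, d] (by rwa [Matrix.det_fin_two_of])

section
variable {a b c d : ℂ} (h : a * d - b * c ≠ 0)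

@[simp] theorem mobius_zero_zero : (mobius a b c d h) 0 0 = a := rfl
@[simp] theorem mobius_zero_one : (mobius a b c d h) 0 1 = b := rfl
@[simp] theorem mobius_one_zero : (mobius a b c d h) 1 0 = c := rfl
@[simp] theorem mobius_one_one : (mobius a b c d h) 1 1 = d := rfl
end

theorem det_two_ne_zero (g : GL (Fin 2) ℂ) : g 0 0 * g 1 1 - g 0 1 * g 1 0 ≠ 0 := by
  rw [← Matrix.det_fin_two]
  exact g.det_ne_zero

theorem smul_coe_eq_coe_iff (g : GL (Fin 2) ℂ) (w u : ℂ) :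
    g • (w : OnePoint ℂ) = u ↔
      g 1 0 * w + g 1 1 ≠ 0 ∧ u * (g 1 0 * w + g 1 1) = g 0 0 * w + g 0 1 := by
  rw [OnePoint.smul_some_eq_ite]
  split_ifs with h
  · simp [h]
  · rw [OnePoint.coe_eq_coe, div_eq_iff h]
    simp [h, eq_comm]

theorem isGivenBy_iff {f : ℂ → ℂ} {g : GL (Fin 2) ℂ} : IsGivenBy f g ↔ ∀ z ∈ disk,
    g 1 0 * z + g 1 1 ≠ 0 ∧ f z * (g 1 0 * z + g 1 1) = g 0 0 * z + g 0 1 := by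
  refine forall₂_congr fun z _ => ?_
  rw [eq_comm, smul_coe_eq_coe_iff]

theorem smul_coe_eq_self_iff (g : GL (Fin 2) ℂ) (w : ℂ) :
    g • (w : OnePoint ℂ) = w ↔ g 1 0 * w ^ 2 + (g 1 1 - g 0 0) * w - g 0 1 = 0 := by
  rw [smul_coe_eq_coe_iff]
  constructor
  · rintro ⟨-, h⟩
    linear_combination h
  · intro h
    -- A root of the quadratic that killed the denominator would kill the numerator too, against
    -- invertibility.
    refine ⟨fun h0 => det_two_ne_zero g ?_, by linear_combination h⟩
    have h1 : g 0 0 * w + g 0 1 = 0 := by linear_combination w * h0 - h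
    by_cases hc : g 1 0 = 0
    · have hd : g 1 1 = 0 := by simpa [hc] using h0
      simp [hc, hd]
    · apply mul_left_cancel₀ hc
      linear_combination (g 0 0 * g 1 0) * h0 - (g 1 0) ^ 2 * h1

/-- Every quadratic polynomial over `ℂ` factors. -/
theorem exists_quadratic_roots {c : ℂ} (hc : c ≠ 0) (e b : ℂ) :
    ∃ r s : ℂ, e = -c * (r + s) ∧ b = -c * (r * s) := by
  obtain ⟨t, ht⟩ := IsAlgClosed.exists_pow_nat_eq (e ^ 2 + 4 * c * b) two_pos
  refine ⟨(-e + t) / (2 * c), (-e - t) / (2 * c), ?_, ?_⟩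
  · field_simp
    ring
  · field_simp
    linear_combination -ht

/-- Invertible matrices with the same fixed points on the sphere commute. -/
theorem mul_comm_of_smul_eq_self_iff {g k : GL (Fin 2) ℂ}
    (hgk : ∀ w : OnePoint ℂ, g • w = w ↔ k • w = w) : g * k = k * g := by
  have hfin : ∀ w : ℂ, g 1 0 * w ^ 2 + (g 1 1 - g 0 0) * w - g 0 1 = 0 ↔
      k 1 0 * w ^ 2 + (k 1 1 - k 0 0) * w - k 0 1 = 0 := fun w => by
    rw [← smul_coe_eq_self_iff, ← smul_coe_eq_self_iff, hgk]
  have hinf : g 1 0 = 0 ↔ k 1 0 = 0 := by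
    rw [← OnePoint.smul_infty_eq_self_iff, ← OnePoint.smul_infty_eq_self_iff, hgk]
  -- The coefficient vectors of the two fixed-point quadratics are parallel; these minors are the
  -- entries of `g * k - k * g` up to sign.
  obtain ⟨h1, h2, h3⟩ : g 0 1 * k 1 0 = k 0 1 * g 1 0 ∧
      (g 1 1 - g 0 0) * k 0 1 = (k 1 1 - k 0 0) * g 0 1 ∧
      (g 1 1 - g 0 0) * k 1 0 = (k 1 1 - k 0 0) * g 1 0 := by
    by_cases hc : g 1 0 = 0
    · have hc' := hinf.1 hc
      simp only [hc, hc', mul_zero, zero_mul, zero_add, and_true, true_and] at hfin ⊢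
      by_cases he : g 1 1 - g 0 0 = 0
      · by_cases he' : k 1 1 - k 0 0 = 0
        · simp [he, he']
        · have := (hfin (k 0 1 / (k 1 1 - k 0 0))).2 (by field_simp; ring)
          field_simp at this
          linear_combination this
      · have := (hfin (g 0 1 / (g 1 1 - g 0 0))).1 (by field_simp; ring)
        field_simp at this
        linear_combination -this
    · have hc' : k 1 0 ≠ 0 := fun h => hc (hinf.2 h)
      obtain ⟨r, s, he, hb⟩ := exists_quadratic_roots hc (g 1 1 - g 0 0) (g 0 1)
      obtain ⟨r', s', he', hb'⟩ := exists_quadratic_roots hc' (k 1 1 - k 0 0) (k 0 1)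
      have fac : ∀ w, (w = r ∨ w = s) ↔ (w = r' ∨ w = s') := fun w => by
        have := hfin w
        rw [he, hb, he', hb', show g 1 0 * w ^ 2 + -g 1 0 * (r + s) * w - -g 1 0 * (r * s)
          = g 1 0 * ((w - r) * (w - s)) by ring, show k 1 0 * w ^ 2 + -k 1 0 * (r' + s') * w -
          -k 1 0 * (r' * s') = k 1 0 * ((w - r') * (w - s')) by ring] at this
        simpa [hc, hc', sub_eq_zero] using this
      -- Equal root sets have equal multiplicities here: two roots are counted, so a one-point set
      -- means a double root on both sides.
      obtain ⟨hs, hp⟩ : r + s = r' + s' ∧ r * s = r' * s' := by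
        have i1 := (fac r).1 (.inl rfl)
        have i2 := (fac s).1 (.inr rfl)
        have i3 := (fac r').2 (.inl rfl)
        have i4 := (fac s').2 (.inr rfl)
        grind
      rw [he, hb, he', hb', hs, hp]
      refine ⟨by ring, by ring, by ring⟩
  ext i j
  fin_cases i <;> fin_cases j <;>
    simp only [Matrix.GeneralLinearGroup.coe_mul, Matrix.mul_apply, Fin.sum_univ_two,
      Fin.zero_eta, Fin.mk_one]
  · linear_combination h1
  · linear_combination -h2
  · linear_combination h3
  · linear_combination -h1

theorem commutes_of_sphereFix_eq {f φ : ℂ → ℂ} (hf : IsSelfMap f) (hφ : IsSelfMap φ)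
    (hf_lft : IsLFT f) (hφ_lft : IsLFT φ) (h : sphereFix f = sphereFix φ) : Commutes f φ := by
  obtain ⟨g, hg⟩ := hf_lft
  obtain ⟨k, hk⟩ := hφ_lft
  rw [sphereFix_eq hg, sphereFix_eq hk] at h
  have hgk := mul_comm_of_smul_eq_self_iff fun w => Set.ext_iff.1 h w
  intro z hz
  rw [← OnePoint.coe_eq_coe, hg _ (hφ.mapsTo hz), hk z hz, hk _ (hf.mapsTo hz), hg z hz,
    smul_smul, smul_smul, hgk]

theorem isGivenBy_conj {f : ℂ → ℂ} {s g : GL (Fin 2) ℂ}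
    (h : ∀ z ∈ disk, s • ((f z : ℂ) : OnePoint ℂ) = g • s • (z : OnePoint ℂ)) :
    IsGivenBy f (s⁻¹ * g * s) := by
  intro z hz
  rw [mul_smul, mul_smul, ← h z hz, inv_smul_smul]

theorem conj_smul_eq_self_iff (s g : GL (Fin 2) ℂ) (w : OnePoint ℂ) :
    (s⁻¹ * g * s) • w = w ↔ g • s • w = s • w := by
  rw [mul_smul, mul_smul, inv_smul_eq_iff]

theorem isLFT_and_sphereFix_eq {f φ : ℂ → ℂ} {s g k : GL (Fin 2) ℂ}
    (hf : IsGivenBy f (s⁻¹ * g * s)) (hφ : IsGivenBy φ (s⁻¹ * k * s))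
    (h : ∀ w : OnePoint ℂ, g • w = w ↔ k • w = w) : IsLFT f ∧ sphereFix f = sphereFix φ := by
  refine ⟨⟨_, hf⟩, ?_⟩
  rw [sphereFix_eq hf, sphereFix_eq hφ]
  ext w
  simp only [Set.mem_ofPred_eq, conj_smul_eq_self_iff, h]

theorem coe_mem_sphereFix_iff {f : ℂ → ℂ} (hf : IsLFT f) {z : ℂ} (hz : z ∈ disk) :
    (z : OnePoint ℂ) ∈ sphereFix f ↔ f z = z := by
  obtain ⟨g, hg⟩ := hf
  rw [sphereFix_eq hg, Set.mem_ofPred_eq, ← hg z hz, OnePoint.coe_eq_coe]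

/-! ### Half-plane coordinates and the affine normal form -/

/-- The Cayley transform of the disk onto the right half-plane that sends `p` to infinity. -/
noncomputable def cayley (p z : ℂ) : ℂ := (p + z) / (p - z)

/-- The inverse of the Cayley transform. -/
noncomputable def cayleyInv (p w : ℂ) : ℂ := p * (w - 1) / (w + 1)

/-- In the half-plane coordinate given by the Cayley transform at `p`, the map `f` is
`w ↦ l * w + b`. -/
def IsAffineAt (f : ℂ → ℂ) (p l b : ℂ) : Prop :=
  ∀ z ∈ disk, cayley p (f z) = l * cayley p z + b

section cayley
variable {p z w : ℂ}

theorem ne_zero_of_norm_eq_one (hp : ‖p‖ = 1) : p ≠ 0 := by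
  rintro rfl
  simp at hp

theorem sub_ne_zero_of_mem_disk (hp : ‖p‖ = 1) (hz : z ∈ disk) : p - z ≠ 0 := by
  intro h
  rw [sub_eq_zero] at h
  rw [mem_disk_iff, ← h, hp] at hz
  exact lt_irrefl _ hz

theorem add_one_ne_zero_of_re_nonneg (hw : 0 ≤ w.re) : w + 1 ≠ 0 := by
  intro h
  have := congrArg Complex.re h
  simp at this
  linarith

theorem cayley_add_one (hz : p - z ≠ 0) : cayley p z + 1 = 2 * p / (p - z) := by
  unfold cayley
  field_simp
  ring

theorem re_cayley_pos (hp : ‖p‖ = 1) (hz : z ∈ disk) : 0 < (cayley p z).re := by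
  have h0 := sub_ne_zero_of_mem_disk hp hz
  have h1 : Complex.normSq z < Complex.normSq p := by
    rw [Complex.normSq_eq_norm_sq, Complex.normSq_eq_norm_sq, hp]
    have := mem_disk_iff.1 hz
    nlinarith [norm_nonneg z]
  rw [Complex.normSq_apply, Complex.normSq_apply] at h1
  rw [cayley, Complex.div_re, ← add_div]
  refine div_pos ?_ (Complex.normSq_pos.2 h0)
  simp only [Complex.add_re, Complex.sub_re, Complex.add_im, Complex.sub_im]
  nlinarith

theorem cayley_add_one_ne_zero (hp : ‖p‖ = 1) (hz : z ∈ disk) : cayley p z + 1 ≠ 0 :=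
  add_one_ne_zero_of_re_nonneg (re_cayley_pos hp hz).le

theorem norm_sub_one_lt (hw : 0 < w.re) : ‖w - 1‖ < ‖w + 1‖ := by
  rw [← sq_lt_sq₀ (norm_nonneg _) (norm_nonneg _), ← Complex.normSq_eq_norm_sq,
    ← Complex.normSq_eq_norm_sq, Complex.normSq_apply, Complex.normSq_apply]
  simp
  nlinarith

theorem cayleyInv_mem_disk (hp : ‖p‖ = 1) (hw : 0 < w.re) : cayleyInv p w ∈ disk := by
  have := norm_sub_one_lt hw
  rw [mem_disk_iff, cayleyInv, norm_div, norm_mul, hp, one_mul, div_lt_one]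
  · exact this
  · exact (norm_nonneg _).trans_lt this

theorem cayley_cayleyInv (hp : ‖p‖ = 1) (hw : 0 ≤ w.re) : cayley p (cayleyInv p w) = w := by
  have h1 := add_one_ne_zero_of_re_nonneg hw
  have h2 := ne_zero_of_norm_eq_one hp
  have h3 : p - cayleyInv p w = 2 * p / (w + 1) := by
    unfold cayleyInv
    field_simp
    ring
  rw [cayley, h3, cayleyInv]
  field_simp
  ring

theorem cayleyInv_cayley (hp : ‖p‖ = 1) (hz : z ∈ disk) : cayleyInv p (cayley p z) = z := by
  have h1 := sub_ne_zero_of_mem_disk hp hz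
  have h2 := ne_zero_of_norm_eq_one hp
  rw [cayleyInv, cayley_add_one h1, cayley]
  field_simp
  ring

theorem cayley_injOn (hp : ‖p‖ = 1) : Set.InjOn (cayley p) disk := fun x hx y hy h => by
  rw [← cayleyInv_cayley hp hx, h, cayleyInv_cayley hp hy]

theorem differentiableOn_cayley (hp : ‖p‖ = 1) : DifferentiableOn ℂ (cayley p) disk := by
  unfold cayley
  exact DifferentiableOn.div (by fun_prop) (by fun_prop) fun z hz => sub_ne_zero_of_mem_disk hp hz

theorem differentiableOn_cayleyInv : DifferentiableOn ℂ (cayleyInv p) {w | 0 < w.re} := by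
  unfold cayleyInv
  exact DifferentiableOn.div (by fun_prop) (by fun_prop) fun w hw =>
    add_one_ne_zero_of_re_nonneg (le_of_lt hw)

end cayley

/-- A linear fractional self-map of the disk has a fixed point in the closed disk. -/
theorem exists_boundary_fixed_point {φ : ℂ → ℂ} {g : GL (Fin 2) ℂ} (hφ : IsSelfMap φ)
    (hg : IsGivenBy φ g) (hfix : ∀ z ∈ disk, φ z ≠ z) :
    ∃ p : ℂ, ‖p‖ = 1 ∧ g 1 0 * p ^ 2 + (g 1 1 - g 0 0) * p - g 0 1 = 0 := by
  rw [isGivenBy_iff] at hg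
  have hdet := det_two_ne_zero g
  set a := g 0 0
  set b := g 0 1
  set c := g 1 0
  set d := g 1 1
  have hcl : closure disk = Metric.closedBall 0 1 := closure_ball _ one_ne_zero
  -- `‖φ z‖ ≤ 1` with denominators cleared passes to the closed disk; a pole there would again be a
  -- common zero.
  have hle : ∀ z ∈ closure disk, ‖a * z + b‖ ≤ ‖c * z + d‖ := by
    apply le_on_closure
    · intro z hz
      rw [← (hg z hz).2, norm_mul]
      exact mul_le_of_le_one_left (norm_nonneg _) (mem_disk_iff.1 (hφ.mapsTo hz)).le
    · fun_prop
    · fun_prop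
  have hden : ∀ z ∈ closure disk, c * z + d ≠ 0 := by
    intro z hz h0
    have h1 := hle z hz
    rw [h0, norm_zero, norm_le_zero_iff] at h1
    apply hdet
    by_cases hc : c = 0
    · have hd : d = 0 := by simpa [hc] using h0
      simp [hc, hd]
    · apply mul_left_cancel₀ hc
      linear_combination (a * c) * h0 - c ^ 2 * h1
  by_contra! hno
  have hP : ∀ z ∈ closure disk, c * z ^ 2 + (d - a) * z - b ≠ 0 := by
    intro z hz h0
    rw [hcl, mem_closedBall_zero_iff] at hz
    rcases hz.lt_or_eq with h | h
    · have hz' := mem_disk_iff.2 h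
      obtain ⟨h1, h2⟩ := hg z hz'
      apply hfix z hz'
      apply mul_right_cancel₀ h1
      linear_combination h2 - h0
    · exact hno z h h0
  -- This is `z / (z - φ z)`. On the circle `‖u - 1‖ ≤ ‖u‖`, that is `1 / 2 ≤ u.re`, while `u 0 =
  -- 0`; the maximum principle for `exp (-u)` is contradicted.
  set u : ℂ → ℂ := fun z => z * (c * z + d) / (c * z ^ 2 + (d - a) * z - b) with hu
  have hdu : DifferentiableOn ℂ (fun z => Complex.exp (-u z)) (closure disk) := by
    refine DifferentiableOn.cexp (DifferentiableOn.neg (DifferentiableOn.div ?_ ?_ hP))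
    · fun_prop
    · fun_prop
  have hbd : ∀ z ∈ frontier disk, ‖Complex.exp (-u z)‖ ≤ Real.exp (-(1 / 2)) := by
    intro z hz
    have hzc := frontier_subset_closure hz
    rw [frontier_ball _ one_ne_zero, mem_sphere_zero_iff_norm] at hz
    rw [Complex.norm_exp, Real.exp_le_exp, Complex.neg_re, neg_le_neg_iff]
    have h1 : ‖u z - 1‖ ≤ ‖u z‖ := by
      have : u z - 1 = (a * z + b) / (c * z ^ 2 + (d - a) * z - b) := by
        rw [hu, div_sub_one (hP z hzc)]
        ring
      rw [this, hu, norm_div, norm_div, norm_mul, hz, one_mul]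
      gcongr
      exact hle z hzc
    rw [← sq_le_sq₀ (norm_nonneg _) (norm_nonneg _), ← Complex.normSq_eq_norm_sq,
      ← Complex.normSq_eq_norm_sq, Complex.normSq_apply, Complex.normSq_apply] at h1
    simp at h1
    linarith
  have := Complex.norm_le_of_forall_mem_frontier_norm_le Metric.isBounded_ball
    hdu.diffContOnCl hbd (subset_closure zero_mem_disk)
  simp [hu] at this
  norm_num at this

/-- With `p` sent to infinity the map fixes infinity, hence is affine. Its slope is the ratio of the
eigenvalues `d + c * p` and `a - p * c` of the matrix. -/
theorem exists_isAffineAt {φ : ℂ → ℂ} {g : GL (Fin 2) ℂ} {p : ℂ}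
    (hg : IsGivenBy φ g) (hp : ‖p‖ = 1)
    (hfix : g 1 0 * p ^ 2 + (g 1 1 - g 0 0) * p - g 0 1 = 0) :
    ∃ l b : ℂ, l ≠ 0 ∧ IsAffineAt φ p l b := by
  rw [isGivenBy_iff] at hg
  have hdet := det_two_ne_zero g
  set a := g 0 0
  set b := g 0 1
  set c := g 1 0
  set d := g 1 1
  clear_value a b c d
  have hb : b = c * p ^ 2 + (d - a) * p := by linear_combination -hfix
  rw [show a * d - b * c = (a - p * c) * (d + c * p) by rw [hb]; ring] at hdet
  obtain ⟨h1, h2⟩ := mul_ne_zero_iff.1 hdet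
  refine ⟨(d + c * p) / (a - p * c), (d - a) / (a - p * c), div_ne_zero h2 h1, fun z hz => ?_⟩
  obtain ⟨h3, h4⟩ := hg z hz
  have h5 := sub_ne_zero_of_mem_disk hp hz
  have h8 : p - φ z = (a - p * c) * (p - z) / (c * z + d) := by
    rw [eq_div_iff h3]
    linear_combination -h4 - hb
  have h9 : p + φ z = ((a + p * c) * z + (p * d + b)) / (c * z + d) := by
    rw [eq_div_iff h3]
    linear_combination h4
  rw [cayley, cayley, h8, h9, div_div_div_cancel_right₀ h3, hb]
  field_simp
  ring

theorem IsAffineAt.re_pos {φ : ℂ → ℂ} {p l b w : ℂ} (h : IsAffineAt φ p l b) (hφ : IsSelfMap φ)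
    (hp : ‖p‖ = 1) (hw : 0 < w.re) : 0 < (l * w + b).re := by
  have hz := cayleyInv_mem_disk hp hw
  rw [← cayley_cayleyInv hp hw.le, ← h _ hz]
  exact re_cayley_pos hp (hφ.mapsTo hz)

/-- An affine self-map of the right half-plane has positive real slope. -/
theorem slope_pos_of_forall_re_pos {l b : ℂ} (hl : l ≠ 0)
    (h : ∀ w : ℂ, 0 < w.re → 0 < (l * w + b).re) : (∃ m : ℝ, 0 < m ∧ l = m) ∧ 0 ≤ b.re := by
  have h1 : ∀ x y : ℝ, 0 < x → 0 < l.re * x - l.im * y + b.re := fun x y hx => by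
    simpa using h ⟨x, y⟩ hx
  have him : l.im = 0 := by
    by_contra h0
    -- This height makes the real part of the image exactly zero.
    have := h1 1 ((l.re + b.re) / l.im) one_pos
    rw [mul_div_cancel₀ _ h0] at this
    linarith
  simp only [him, zero_mul, sub_zero] at h1
  have hre : 0 ≤ l.re := by
    by_contra! h0
    have := h1 ((|b.re| + 1) / (-l.re)) 0 (div_pos (by positivity) (by linarith))
    rw [div_neg, mul_neg, mul_div_cancel₀ _ h0.ne] at this
    linarith [le_abs_self b.re]
  refine ⟨⟨l.re, lt_of_le_of_ne hre fun h0 => hl ?_, ?_⟩, ?_⟩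
  · apply Complex.ext <;> simp [him, ← h0]
  · apply Complex.ext <;> simp [him]
  · by_contra! h0
    have h2 := h1 (-b.re / (l.re + 1)) 0 (div_pos (by linarith) (by linarith))
    have h3 : -b.re / (l.re + 1) * (l.re + 1) = -b.re := div_mul_cancel₀ _ (by linarith)
    have h4 : 0 < -b.re / (l.re + 1) := div_pos (by linarith) (by linarith)
    linarith

/-- If the fixed point `p` is repelling, then the other fixed point on the circle is attracting. -/
theorem IsAffineAt.exists_inv {φ : ℂ → ℂ} {p b : ℂ} {l : ℝ} (h : IsAffineAt φ p l b)
    (hφ : IsSelfMap φ) (hfix : ∀ z ∈ disk, φ z ≠ z) (hp : ‖p‖ = 1) (hl : 0 < l) (hl1 : l < 1)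
    (hb : 0 ≤ b.re) : ∃ q b' : ℂ, ‖q‖ = 1 ∧ 0 ≤ b'.re ∧ IsAffineAt φ q (l⁻¹ : ℝ) b' := by
  have hl1' : (1 - l : ℂ) ≠ 0 := by exact_mod_cast (sub_pos.2 hl1).ne'
  have hl0 : (l : ℂ) ≠ 0 := by exact_mod_cast hl.ne'
  -- `w₀` is the finite fixed point. It is on the imaginary axis: `0 ≤ b.re` rules out the left
  -- side, and the absence of fixed points in the disk the right side.
  obtain ⟨w₀, hw₀⟩ : ∃ w₀ : ℂ, b = (1 - l) * w₀ := ⟨b / (1 - l), by field_simp⟩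
  have hre : b.re = (1 - l) * w₀.re := by
    rw [hw₀]
    simp
  have hw₀re : w₀.re = 0 := by
    rcases lt_trichotomy w₀.re 0 with h0 | h0 | h0
    · nlinarith
    · exact h0
    · have hz := cayleyInv_mem_disk hp h0
      refine absurd (cayley_injOn hp (hφ.mapsTo hz) hz ?_) (hfix _ hz)
      rw [h _ hz, cayley_cayleyInv hp h0.le, hw₀]
      ring
  have hw1 := add_one_ne_zero_of_re_nonneg hw₀re.ge
  have hp0 := ne_zero_of_norm_eq_one hp
  have hq : ‖cayleyInv p w₀‖ = 1 := by
    rw [cayleyInv, norm_div, norm_mul, hp, one_mul, div_eq_one_iff_eq (norm_ne_zero_iff.2 hw1),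
      ← sq_eq_sq₀ (norm_nonneg _) (norm_nonneg _), ← Complex.normSq_eq_norm_sq,
      ← Complex.normSq_eq_norm_sq, Complex.normSq_apply, Complex.normSq_apply]
    simp [hw₀re]
  have hne : ∀ z ∈ disk, cayley p z - w₀ ≠ 0 := fun z hz h0 => by
    have := re_cayley_pos hp hz
    rw [sub_eq_zero.1 h0, hw₀re] at this
    exact lt_irrefl _ this
  -- Changing coordinates from `p` to the other fixed point is an inversion exchanging `w₀` and
  -- infinity, so the slope is inverted.
  have key : ∀ z ∈ disk, cayley (cayleyInv p w₀) z = (1 - w₀ ^ 2) / (cayley p z - w₀) - w₀ := by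
    intro z hz
    have h1 := hne z hz
    have h2 := cayley_add_one_ne_zero hp hz
    have h3 := cayleyInv_cayley hp hz
    set w := cayley p z
    have h4 : cayleyInv p w₀ - z = 2 * p * (w₀ - w) / ((w₀ + 1) * (w + 1)) := by
      rw [← h3, cayleyInv, cayleyInv]
      field_simp
      ring
    have h5 : w₀ - w ≠ 0 := by rwa [← neg_sub, neg_ne_zero] at h1
    rw [cayley, h4, ← h3, cayleyInv, cayleyInv]
    field_simp
    ring
  refine ⟨cayleyInv p w₀, w₀ * (l⁻¹ - 1), hq, ?_, fun z hz => ?_⟩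
  · rw [← Complex.ofReal_one, ← Complex.ofReal_sub, mul_comm,
      Complex.re_ofReal_mul, hw₀re, mul_zero]
  · have h1 := hne z hz
    rw [key z hz, key _ (hφ.mapsTo hz), h z hz, hw₀, show l * cayley p z + (1 - l) * w₀ - w₀
      = l * (cayley p z - w₀) by ring, Complex.ofReal_inv]
    field_simp
    ring

/-- A linear fractional self-map of the disk without fixed points in the disk is, in a suitable
half-plane coordinate, affine with slope at least one. -/
theorem exists_isAffineAt_one_le {φ : ℂ → ℂ} (hφ : IsSelfMap φ) (hφ_lft : IsLFT φ)
    (hfix : ∀ z ∈ disk, φ z ≠ z) : ∃ (p b : ℂ) (l : ℝ), ‖p‖ = 1 ∧ 1 ≤ l ∧ 0 ≤ b.re ∧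
      (l = 1 → b ≠ 0) ∧ IsAffineAt φ p l b := by
  suffices ∃ (p b : ℂ) (l : ℝ), ‖p‖ = 1 ∧ 1 ≤ l ∧ 0 ≤ b.re ∧ IsAffineAt φ p l b by
    obtain ⟨p, b, l, hp, hl, hb, h⟩ := this
    refine ⟨p, b, l, hp, hl, hb, ?_, h⟩
    rintro rfl rfl
    refine hfix 0 zero_mem_disk (cayley_injOn hp (hφ.mapsTo zero_mem_disk) zero_mem_disk ?_)
    simpa using h 0 zero_mem_disk
  obtain ⟨g, hg⟩ := hφ_lft
  obtain ⟨p, hp, hroot⟩ := exists_boundary_fixed_point hφ hg hfix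
  obtain ⟨l, b, hl, h⟩ := exists_isAffineAt hg hp hroot
  obtain ⟨⟨m, hm, rfl⟩, hb⟩ := slope_pos_of_forall_re_pos hl fun w hw => h.re_pos hφ hp hw
  rcases le_or_gt 1 m with h1 | h1
  · exact ⟨p, b, m, hp, h1, hb, h⟩
  · obtain ⟨q, b', hq, hb', h'⟩ := h.exists_inv hφ hfix hp hm h1 hb
    exact ⟨q, b', m⁻¹, hq, (one_le_inv₀ hm).2 h1.le, hb', h'⟩

/-! ### Denjoy-Wolff point and angular derivative of an affine model -/

section types
variable {φ : ℂ → ℂ} {p b : ℂ} {l : ℝ}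

theorem IsSelfMap.iterate_mem (hφ : IsSelfMap φ) {z : ℂ} (hz : z ∈ disk) (n : ℕ) :
    φ^[n] z ∈ disk := hφ.mapsTo.iterate n hz

/-- The iterates converge to `p` locally uniformly as soon as they converge to infinity locally
uniformly in the half-plane coordinate. -/
theorem tendstoLocallyUniformlyOn_iterate (hφ : IsSelfMap φ) (hp : ‖p‖ = 1)
    (h : ∀ x ∈ disk, ∃ t ∈ 𝓝[disk] x, ∃ ρ : ℕ → ℝ, Tendsto ρ atTop atTop ∧
      ∀ n, ∀ y ∈ t, y ∈ disk → ρ n ≤ ‖cayley p (φ^[n] y) + 1‖) :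
    TendstoLocallyUniformlyOn (fun (n : ℕ) (z : ℂ) => φ^[n] z) (fun _ => p) atTop disk := by
  rw [Metric.tendstoLocallyUniformlyOn_iff]
  intro ε hε x hx
  obtain ⟨t, ht, ρ, hρ, hle⟩ := h x hx
  refine ⟨t ∩ disk, inter_mem ht self_mem_nhdsWithin, ?_⟩
  filter_upwards [hρ.eventually_gt_atTop (2 / ε)] with n hn y hy
  have h1 := hφ.iterate_mem hy.2 n
  have h2 := sub_ne_zero_of_mem_disk hp h1
  have h3 := hn.trans_le (hle n y hy.1 hy.2)
  rw [cayley_add_one h2, norm_div, norm_mul, hp, Complex.norm_ofNat, mul_one] at h3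
  rw [dist_eq_norm]
  rwa [div_lt_div_iff_of_pos_left two_pos hε (norm_pos_iff.2 h2)] at h3

theorem IsAffineAt.iterate_of_eq_one (h : IsAffineAt φ p 1 b) (hφ : IsSelfMap φ) {z : ℂ}
    (hz : z ∈ disk) (n : ℕ) : cayley p (φ^[n] z) = cayley p z + n * b := by
  induction n with
  | zero => simp
  | succ n ih =>
    rw [Function.iterate_succ_apply', h _ (hφ.iterate_mem hz n), ih]
    push_cast
    ring

theorem IsAffineAt.le_re_iterate (h : IsAffineAt φ p l b) (hφ : IsSelfMap φ) (hl : 0 ≤ l)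
    (hb : 0 ≤ b.re) {z : ℂ} (hz : z ∈ disk) (n : ℕ) :
    l ^ n * (cayley p z).re ≤ (cayley p (φ^[n] z)).re := by
  induction n with
  | zero => simp
  | succ n ih =>
    rw [Function.iterate_succ_apply', h _ (hφ.iterate_mem hz n), Complex.add_re,
      Complex.re_ofReal_mul, pow_succ']
    nlinarith

/-- For slope one the orbit is `w + n * b`, escaping uniformly on bounded sets; for larger slope its
real part grows at least like `l ^ n`. -/
theorem IsAffineAt.isBoundaryDenjoyWolffPoint (h : IsAffineAt φ p l b) (hφ : IsSelfMap φ)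
    (hfix : ∀ z ∈ disk, φ z ≠ z) (hp : ‖p‖ = 1) (hl : 1 ≤ l) (hb : 0 ≤ b.re)
    (hlb : l = 1 → b ≠ 0) : IsBoundaryDenjoyWolffPoint φ p := by
  refine ⟨hfix, hp, tendstoLocallyUniformlyOn_iterate hφ hp fun x hx => ?_⟩
  have hc : ContinuousWithinAt (cayley p) disk x := (differentiableOn_cayley hp).continuousOn x hx
  rcases hl.eq_or_lt with rfl | hl
  · rw [Complex.ofReal_one] at h
    have hb0 := norm_pos_iff.2 (hlb rfl)
    refine ⟨{y | ‖cayley p y‖ < ‖cayley p x‖ + 1}, hc.norm.eventually_lt_const (lt_add_one _),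
      fun n => n * ‖b‖ - (‖cayley p x‖ + 1) - 1, ?_, fun n y hy hyd => ?_⟩
    · simp only [sub_eq_add_neg]
      exact tendsto_atTop_add_const_right _ _ (tendsto_atTop_add_const_right _ _
        (tendsto_natCast_atTop_atTop.atTop_mul_const hb0))
    · rw [h.iterate_of_eq_one hφ hyd]
      have h1 : ‖(n : ℂ) * b‖ = n * ‖b‖ := by simp
      have h2 := norm_sub_le (cayley p y + n * b + 1) (cayley p y + 1)
      have h3 := norm_add_le (cayley p y) 1
      rw [show cayley p y + n * b + 1 - (cayley p y + 1) = n * b by ring, h1] at h2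
      rw [norm_one] at h3
      have h4 : ‖cayley p y‖ < ‖cayley p x‖ + 1 := hy
      linarith
  · have hpos := re_cayley_pos hp hx
    refine ⟨{y | (cayley p x).re / 2 < (cayley p y).re},
      (Complex.continuous_re.continuousAt.comp_continuousWithinAt hc).eventually_const_lt
        (half_lt_self hpos),
      fun n => l ^ n * ((cayley p x).re / 2), ?_, fun n y hy hyd => ?_⟩
    · exact (tendsto_pow_atTop_atTop_of_one_lt hl).atTop_mul_const (half_pos hpos)
    · have h1 := h.le_re_iterate hφ (zero_le_one.trans hl.le) hb hyd n
      have h2 : (cayley p x).re / 2 < (cayley p y).re := hy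
      have h3 := Complex.re_le_norm (cayley p (φ^[n] y) + 1)
      rw [Complex.add_re, Complex.one_re] at h3
      have h4 : l ^ n * ((cayley p x).re / 2) ≤ l ^ n * (cayley p y).re := by
        gcongr
      linarith

theorem stolz_subset_disk (p : ℂ) (M : ℝ) : stolz p M ⊆ disk := fun _ hz => mem_disk_iff.2 hz.1

/-- Slope `l` at infinity reads as derivative `l⁻¹` at `p`: `p - φ z = ψ z * (p - z)` with `ψ`
continuous at `p` and `ψ p = l⁻¹`. The limits therefore need no restriction to Stolz regions beyond
lying in the disk. -/
theorem IsAffineAt.hasAngularDeriv (h : IsAffineAt φ p l b) (hφ : IsSelfMap φ) (hp : ‖p‖ = 1)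
    (hl : l ≠ 0) : HasAngularDeriv φ p ((l⁻¹ : ℝ) : ℂ) := by
  have hp0 := ne_zero_of_norm_eq_one hp
  have hl0 : (l : ℂ) ≠ 0 := by exact_mod_cast hl
  set ψ : ℂ → ℂ := fun z => 2 * p / (2 * p * l + (1 - l + b) * (p - z)) with hψ
  have hψp : ψ p = ((l⁻¹ : ℝ) : ℂ) := by
    simp only [hψ, sub_self, mul_zero, add_zero, Complex.ofReal_inv]
    field_simp
  have hψc : Tendsto ψ (𝓝 p) (𝓝 ((l⁻¹ : ℝ) : ℂ)) := by
    rw [← hψp]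
    refine ContinuousAt.div (by fun_prop) (by fun_prop) ?_
    simp [hp0, hl]
  have key : ∀ z ∈ disk, p - φ z = ψ z * (p - z) := by
    intro z hz
    have h1 := sub_ne_zero_of_mem_disk hp hz
    have h2 := sub_ne_zero_of_mem_disk hp (hφ.mapsTo hz)
    have h3 := cayley_add_one h2
    have h4 : cayley p z = 2 * p / (p - z) - 1 := by
      rw [← cayley_add_one h1]
      ring
    have h5 := cayley_add_one_ne_zero hp (hφ.mapsTo hz)
    have h6 : p - φ z = 2 * p / (cayley p (φ z) + 1) := by
      rw [h3]
      field_simp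
    have h7 : cayley p (φ z) + 1 = (2 * p * l + (1 - l + b) * (p - z)) / (p - z) := by
      rw [h z hz, h4]
      field_simp
      ring
    rw [h6, h7, div_div_eq_mul_div, div_mul_eq_mul_div]
  refine ⟨p, hp, fun M => ?_, fun M => ?_⟩
  · have h1 : Tendsto (fun z => p - ψ z * (p - z)) (𝓝 p) (𝓝 p) := by
      have := (hψc.mul ((continuous_const.sub continuous_id).tendsto p :
        Tendsto (fun z : ℂ => p - z) _ _)).const_sub p
      simpa using this
    refine (h1.mono_left nhdsWithin_le_nhds).congr' ?_
    filter_upwards [self_mem_nhdsWithin] with z hz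
    rw [← key z (stolz_subset_disk p M hz)]
    ring
  · refine (hψc.mono_left nhdsWithin_le_nhds).congr' ?_
    filter_upwards [self_mem_nhdsWithin] with z hz
    have hz' := stolz_subset_disk p M hz
    have h1 := sub_ne_zero_of_mem_disk hp hz'
    have h2 : z - p ≠ 0 := by rwa [← neg_sub, neg_ne_zero] at h1
    rw [eq_div_iff h2]
    linear_combination key z hz'

theorem IsAffineAt.isParabolic (h : IsAffineAt φ p 1 b) (hφ : IsSelfMap φ)
    (hfix : ∀ z ∈ disk, φ z ≠ z) (hp : ‖p‖ = 1) (hb : 0 ≤ b.re) (hb0 : b ≠ 0) :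
    IsParabolic φ := by
  rw [← Complex.ofReal_one] at h
  refine ⟨p, h.isBoundaryDenjoyWolffPoint hφ hfix hp le_rfl hb fun _ => hb0, ?_⟩
  simpa using h.hasAngularDeriv hφ hp one_ne_zero

theorem IsAffineAt.isHyperbolic (h : IsAffineAt φ p l b) (hφ : IsSelfMap φ)
    (hfix : ∀ z ∈ disk, φ z ≠ z) (hp : ‖p‖ = 1) (hl : 1 < l) (hb : 0 ≤ b.re) :
    IsHyperbolic φ :=
  ⟨p, h.isBoundaryDenjoyWolffPoint hφ hfix hp hl.le hb fun h1 => absurd h1 hl.ne', l⁻¹,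
    h.hasAngularDeriv hφ hp (zero_lt_one.trans hl).ne', inv_lt_one_of_one_lt₀ hl⟩

end types

/-! ### Fixed points on the sphere and the dynamic type -/

section fixedPoints
variable {f φ : ℂ → ℂ} {p l b m c : ℂ}

/-- The Cayley transform as a linear fractional transformation of the sphere. -/
noncomputable def cayleyGL (hp : ‖p‖ = 1) : GL (Fin 2) ℂ :=
  mobius 1 p (-1) p (by
    rw [show 1 * p - p * -1 = 2 * p by ring]
    exact mul_ne_zero two_ne_zero (ne_zero_of_norm_eq_one hp))

/-- The map `w ↦ l * w + b` of the sphere. -/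
noncomputable def affineGL (hl : l ≠ 0) (b : ℂ) : GL (Fin 2) ℂ :=
  mobius l b 0 1 (by simpa using hl)

theorem cayleyGL_smul (hp : ‖p‖ = 1) {z : ℂ} (hz : z ∈ disk) :
    cayleyGL hp • (z : OnePoint ℂ) = cayley p z := by
  have h := sub_ne_zero_of_mem_disk hp hz
  rw [cayleyGL, smul_coe_eq_coe_iff]
  simp only [mobius_one_zero, mobius_one_one, mobius_zero_zero, mobius_zero_one]
  refine ⟨by rwa [neg_one_mul, neg_add_eq_sub], ?_⟩
  rw [cayley, neg_one_mul, neg_add_eq_sub, div_mul_cancel₀ _ h]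
  ring

theorem affineGL_smul_coe (hl : l ≠ 0) (b w : ℂ) :
    affineGL hl b • (w : OnePoint ℂ) = (l * w + b : ℂ) := by
  rw [affineGL, smul_coe_eq_coe_iff]
  simp

theorem affineGL_smul_infty (hl : l ≠ 0) (b : ℂ) :
    affineGL hl b • (OnePoint.infty : OnePoint ℂ) = OnePoint.infty := by
  rw [OnePoint.smul_infty_eq_self_iff, affineGL, mobius_one_zero]

theorem IsAffineAt.isGivenBy (h : IsAffineAt φ p l b) (hφ : IsSelfMap φ) (hp : ‖p‖ = 1)
    (hl : l ≠ 0) : IsGivenBy φ ((cayleyGL hp)⁻¹ * affineGL hl b * cayleyGL hp) := by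
  refine isGivenBy_conj fun z hz => ?_
  rw [cayleyGL_smul hp hz, cayleyGL_smul hp (hφ.mapsTo hz), affineGL_smul_coe, h z hz]

theorem IsAffineAt.isLFT_and_sphereFix_eq (h : IsAffineAt φ p l b) (h' : IsAffineAt f p m c)
    (hφ : IsSelfMap φ) (hf : IsSelfMap f) (hp : ‖p‖ = 1) (hl : l ≠ 0) (hm : m ≠ 0)
    (hfix : ∀ w, m * w + c = w ↔ l * w + b = w) : IsLFT f ∧ sphereFix f = sphereFix φ := by
  refine DiskMap.isLFT_and_sphereFix_eq (h'.isGivenBy hf hp hm) (h.isGivenBy hφ hp hl) fun w => ?_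
  cases w with
  | infty => simp only [affineGL_smul_infty]
  | coe w => simp only [affineGL_smul_coe, OnePoint.coe_eq_coe, hfix]

/-- Infinity is always fixed in the half-plane coordinate, and a finite fixed point `b / (1 - l)`
exists exactly when `l ≠ 1`; `hlb` excludes the identity. -/
theorem IsAffineAt.subsingleton_sphereFix_iff (h : IsAffineAt φ p l b) (hφ : IsSelfMap φ)
    (hp : ‖p‖ = 1) (hl : l ≠ 0) (hlb : l = 1 → b ≠ 0) :
    (sphereFix φ).Subsingleton ↔ l = 1 := by
  rw [sphereFix_eq (h.isGivenBy hφ hp hl)]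
  constructor
  · intro hs
    by_contra h1
    have h2 : 1 - l ≠ 0 := sub_ne_zero.2 (Ne.symm h1)
    have := @hs ((cayleyGL hp)⁻¹ • OnePoint.infty)
      (by rw [Set.mem_ofPred_eq, conj_smul_eq_self_iff, smul_inv_smul, affineGL_smul_infty])
      ((cayleyGL hp)⁻¹ • ((b / (1 - l) : ℂ) : OnePoint ℂ)) (by
        rw [Set.mem_ofPred_eq, conj_smul_eq_self_iff, smul_inv_smul, affineGL_smul_coe,
          OnePoint.coe_eq_coe]
        field_simp
        ring)
    exact OnePoint.infty_ne_coe _ (smul_left_cancel _ this)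
  · intro h1
    have key : ∀ w : OnePoint ℂ, affineGL hl b • w = w → w = OnePoint.infty := by
      intro w hw
      cases w with
      | infty => rfl
      | coe w =>
        rw [affineGL_smul_coe, OnePoint.coe_eq_coe, h1, one_mul, add_eq_left] at hw
        exact absurd hw (hlb h1)
    intro x hx y hy
    rw [Set.mem_ofPred_eq, conj_smul_eq_self_iff] at hx hy
    exact smul_left_cancel _ ((key _ hx).trans (key _ hy).symm)

theorem hasType_of_sphereFix {φ : ℂ → ℂ} (hφ : IsSelfMap φ) (hφ_lft : IsLFT φ)
    (hfix : ∀ z ∈ disk, φ z ≠ z) :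
    ((sphereFix φ).Subsingleton → IsParabolic φ) ∧
      (¬ (sphereFix φ).Subsingleton → IsHyperbolic φ) := by
  obtain ⟨p, b, l, hp, hl, hb, hlb, h⟩ := exists_isAffineAt_one_le hφ hφ_lft hfix
  have hl0 : (l : ℂ) ≠ 0 := by exact_mod_cast (zero_lt_one.trans_le hl).ne'
  rw [h.subsingleton_sphereFix_iff hφ hp hl0 (by exact_mod_cast hlb), Complex.ofReal_eq_one]
  constructor
  · rintro rfl
    rw [Complex.ofReal_one] at h
    exact h.isParabolic hφ hfix hp hb (hlb rfl)
  · intro h1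
    exact h.isHyperbolic hφ hfix hp (lt_of_le_of_ne hl (Ne.symm h1)) hb

/-- The fixed points on the sphere determine the dynamic type of a linear fractional self-map. -/
theorem exists_hasType_of_sphereFix_eq {f φ : ℂ → ℂ} (hf : IsSelfMap f) (hφ : IsSelfMap φ)
    (hf_lft : IsLFT f) (hφ_lft : IsLFT φ) (hf_id : ¬ IsIdentity f) (hφ_id : ¬ IsIdentity φ)
    (h : sphereFix f = sphereFix φ) : ∃ t : DynamicType, HasType φ t ∧ HasType f t := by
  have hiff : ∀ z ∈ disk, (f z = z ↔ φ z = z) := fun z hz => by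
    rw [← coe_mem_sphereFix_iff hf_lft hz, h, coe_mem_sphereFix_iff hφ_lft hz]
  by_cases hfix : ∀ z ∈ disk, φ z ≠ z
  · have tφ := hasType_of_sphereFix hφ hφ_lft hfix
    have tf := hasType_of_sphereFix hf hf_lft fun z hz => (hiff z hz).not.2 (hfix z hz)
    rw [h] at tf
    by_cases hs : (sphereFix φ).Subsingleton
    · exact ⟨.parabolic, tφ.1 hs, tf.1 hs⟩
    · exact ⟨.hyperbolic, tφ.2 hs, tf.2 hs⟩
  · push Not at hfix
    obtain ⟨z, hz, h0⟩ := hfix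
    exact ⟨.elliptic, ⟨hφ_id, z, hz, h0⟩, ⟨hf_id, z, hz, (hiff z hz).2 h0⟩⟩

end fixedPoints

/-! ### Fixed point in the disk: Schwarz's lemma and linearization -/

theorem IsSelfMap.analyticOnNhd {f : ℂ → ℂ} (hf : IsSelfMap f) : AnalyticOnNhd ℂ f disk :=
  hf.differentiableOn.analyticOnNhd Metric.isOpen_ball

theorem isPreconnected_disk : IsPreconnected disk := (convex_ball (0 : ℂ) 1).isPreconnected

theorem disk_mem_nhds_zero : disk ∈ 𝓝 (0 : ℂ) := Metric.ball_mem_nhds _ one_pos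

section involution
variable {a z : ℂ}

/-- The involution of the disk that exchanges `a` and `0`. -/
noncomputable def invol (a z : ℂ) : ℂ := (a - z) / (1 - conj a * z)

theorem one_sub_conj_mul_ne_zero (ha : a ∈ disk) (hz : z ∈ disk) : 1 - conj a * z ≠ 0 := by
  intro h
  rw [sub_eq_zero] at h
  have := congrArg norm h
  rw [norm_one, norm_mul, Complex.norm_conj] at this
  rw [mem_disk_iff] at ha hz
  nlinarith [norm_nonneg a, norm_nonneg z]

theorem one_sub_conj_mul_self_ne_zero (ha : a ∈ disk) : 1 - a * conj a ≠ 0 := by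
  rw [mul_comm]
  exact one_sub_conj_mul_ne_zero ha ha

theorem isSelfMap_invol (ha : a ∈ disk) : IsSelfMap (invol a) := by
  refine ⟨?_, fun z hz => ?_⟩
  · unfold invol
    exact DifferentiableOn.div (by fun_prop) (by fun_prop) fun z hz =>
      one_sub_conj_mul_ne_zero ha hz
  · have h := one_sub_conj_mul_ne_zero ha hz
    rw [mem_disk_iff, invol, norm_div, div_lt_one (norm_pos_iff.2 h)]
    rw [mem_disk_iff] at ha hz
    have h1 : Complex.normSq a < 1 := by
      rw [Complex.normSq_eq_norm_sq]
      nlinarith [norm_nonneg a]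
    have h2 : Complex.normSq z < 1 := by
      rw [Complex.normSq_eq_norm_sq]
      nlinarith [norm_nonneg z]
    rw [← sq_lt_sq₀ (norm_nonneg _) (norm_nonneg _), ← Complex.normSq_eq_norm_sq,
      ← Complex.normSq_eq_norm_sq]
    have h3 : Complex.normSq (1 - conj a * z) - Complex.normSq (a - z) =
        (1 - Complex.normSq a) * (1 - Complex.normSq z) := by
      simp only [Complex.normSq_apply, Complex.sub_re, Complex.sub_im, Complex.mul_re,
        Complex.mul_im, Complex.conj_re, Complex.conj_im, Complex.one_re, Complex.one_im]
      ring
    nlinarith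

theorem invol_invol (ha : a ∈ disk) (hz : z ∈ disk) : invol a (invol a z) = z := by
  have h1 := one_sub_conj_mul_ne_zero ha hz
  have h2 := one_sub_conj_mul_self_ne_zero ha
  have h3 : 1 - conj a * invol a z = (1 - a * conj a) / (1 - conj a * z) := by
    rw [invol, eq_div_iff h1, sub_mul, mul_assoc, div_mul_cancel₀ _ h1]
    ring
  have h4 : a - invol a z = z * (1 - a * conj a) / (1 - conj a * z) := by
    rw [invol, eq_div_iff h1, sub_mul, div_mul_cancel₀ _ h1]
    ring
  rw [invol, h3, h4, div_div_div_cancel_right₀ h1, mul_div_cancel_right₀ _ h2]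

theorem bijOn_invol (ha : a ∈ disk) : Set.BijOn (invol a) disk disk := by
  have h := (isSelfMap_invol ha).mapsTo
  exact Set.InvOn.bijOn ⟨fun z hz => invol_invol ha hz, fun z hz => invol_invol ha hz⟩ h h

@[simp] theorem invol_zero : invol a 0 = a := by simp [invol]

@[simp] theorem invol_self : invol a a = 0 := by simp [invol]

/-- The involution of the disk as a linear fractional transformation of the sphere. -/
noncomputable def involGL (ha : a ∈ disk) : GL (Fin 2) ℂ :=
  mobius (-1) a (-conj a) 1 (by
    have := one_sub_conj_mul_self_ne_zero ha
    intro h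
    apply this
    linear_combination -h)

theorem involGL_smul (ha : a ∈ disk) (hz : z ∈ disk) :
    involGL ha • (z : OnePoint ℂ) = invol a z := by
  have h := one_sub_conj_mul_ne_zero ha hz
  rw [involGL, smul_coe_eq_coe_iff]
  simp only [mobius_one_zero, mobius_one_one, mobius_zero_zero, mobius_zero_one]
  rw [show -conj a * z + 1 = 1 - conj a * z by ring]
  refine ⟨h, ?_⟩
  rw [invol, div_mul_cancel₀ _ h]
  ring

theorem IsSelfMap.comp {f g : ℂ → ℂ} (hf : IsSelfMap f) (hg : IsSelfMap g) :
    IsSelfMap (f ∘ g) :=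
  ⟨hf.differentiableOn.comp hg.differentiableOn hg.mapsTo, hf.mapsTo.comp hg.mapsTo⟩

/-- The conjugate of a self-map under the involution exchanging `a` and `0`. -/
noncomputable def involConj (a : ℂ) (f : ℂ → ℂ) : ℂ → ℂ := invol a ∘ f ∘ invol a

theorem isSelfMap_involConj {f : ℂ → ℂ} (ha : a ∈ disk) (hf : IsSelfMap f) :
    IsSelfMap (involConj a f) := (isSelfMap_invol ha).comp (hf.comp (isSelfMap_invol ha))

theorem involConj_invol {f : ℂ → ℂ} (ha : a ∈ disk) (hz : z ∈ disk) :
    involConj a f (invol a z) = invol a (f z) := by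
  simp [involConj, invol_invol ha hz]

theorem involConj_involConj {f : ℂ → ℂ} (ha : a ∈ disk) (hf : IsSelfMap f) (hz : z ∈ disk) :
    involConj a (involConj a f) z = f z := by
  rw [involConj, Function.comp_apply, Function.comp_apply, involConj_invol ha hz,
    invol_invol ha (hf.mapsTo hz)]

theorem isAutomorphism_of_involConj {f : ℂ → ℂ} (ha : a ∈ disk) (hf : IsSelfMap f)
    (h : IsAutomorphism (involConj a f)) : IsAutomorphism f := by
  have : IsAutomorphism (involConj a (involConj a f)) :=
    (bijOn_invol ha).comp (h.comp (bijOn_invol ha))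
  exact this.congr fun z hz => involConj_involConj ha hf hz

theorem isGivenBy_of_involConj {f : ℂ → ℂ} {g : GL (Fin 2) ℂ} (ha : a ∈ disk) (hf : IsSelfMap f)
    (hg : IsGivenBy (involConj a f) g) : IsGivenBy f ((involGL ha)⁻¹ * g * involGL ha) := by
  refine isGivenBy_conj fun z hz => ?_
  rw [involGL_smul ha hz, involGL_smul ha (hf.mapsTo hz), ← hg _ ((isSelfMap_invol ha).mapsTo hz),
    involConj_invol ha hz]

theorem isLFT_involConj {f : ℂ → ℂ} (ha : a ∈ disk) (hf : IsSelfMap f) (h : IsLFT f) :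
    IsLFT (involConj a f) := by
  obtain ⟨g, hg⟩ := h
  refine ⟨_, isGivenBy_of_involConj (g := g) ha (isSelfMap_involConj ha hf) fun z hz => ?_⟩
  rw [involConj_involConj ha hf hz, hg z hz]

end involution

/-- The strict Schwarz lemma for self-maps that are not automorphisms. -/
theorem norm_dslope_lt_one {Φ : ℂ → ℂ} (hΦ : IsSelfMap Φ) (h0 : Φ 0 = 0)
    (haut : ¬ IsAutomorphism Φ) {z : ℂ} (hz : z ∈ disk) : ‖dslope Φ 0 z‖ < 1 := by
  have hmaps : Set.MapsTo Φ (Metric.ball 0 1) (Metric.closedBall (Φ 0) 1) := by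
    rw [h0]
    exact hΦ.mapsTo.mono_right Metric.ball_subset_closedBall
  -- Equality in Schwarz's lemma makes `Φ` a rotation, hence an automorphism.
  refine lt_of_le_of_ne ?_ fun h => haut ?_
  · simpa using Complex.norm_dslope_le_div_of_mapsTo_ball hΦ.differentiableOn hmaps hz
  · obtain ⟨C, hC, heq⟩ := Complex.affine_of_mapsTo_ball_of_exists_norm_dslope_eq_div'
      hΦ.differentiableOn hmaps ⟨z, hz, by simpa using h⟩
    simp only [h0, zero_add, sub_zero, smul_eq_mul, div_one] at hC heq
    have hC0 := ne_zero_of_norm_eq_one hC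
    refine Set.BijOn.congr (f₁ := fun w => w * C) ?_ heq.symm
    refine Set.InvOn.bijOn (f' := fun w => w * C⁻¹)
      ⟨fun w _ => mul_inv_cancel_right₀ hC0 w, fun w _ => inv_mul_cancel_right₀ hC0 w⟩ ?_ ?_ <;>
    · intro w hw
      rw [mem_disk_iff] at hw ⊢
      simpa [hC] using hw

theorem norm_lt_of_not_isAutomorphism {Φ : ℂ → ℂ} (hΦ : IsSelfMap Φ) (h0 : Φ 0 = 0)
    (haut : ¬ IsAutomorphism Φ) {z : ℂ} (hz : z ∈ disk) (hz0 : z ≠ 0) : ‖Φ z‖ < ‖z‖ := by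
  have h := norm_dslope_lt_one hΦ h0 haut hz
  rwa [dslope_of_ne _ hz0, slope_def_field, h0, sub_zero, sub_zero, norm_div,
    div_lt_one (norm_pos_iff.2 hz0)] at h

theorem hasDerivAt_of_mul_eq {Φ : ℂ → ℂ} {α γ : ℂ}
    (h : ∀ z ∈ disk, γ * z + 1 ≠ 0 ∧ Φ z * (γ * z + 1) = α * z) : HasDerivAt Φ α 0 := by
  have h1 : HasDerivAt (fun z : ℂ => α * z / (γ * z + 1)) α 0 := by
    have h2 : HasDerivAt (fun z : ℂ => α * z) α 0 := by
      simpa using (hasDerivAt_id (0 : ℂ)).const_mul α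
    have h3 : HasDerivAt (fun z : ℂ => γ * z + 1) γ 0 := by
      simpa using ((hasDerivAt_id (0 : ℂ)).const_mul γ).add_const 1
    have h4 := h2.fun_div h3 (by simp)
    simpa using h4
  refine h1.congr_of_eventuallyEq ?_
  filter_upwards [disk_mem_nhds_zero] with z hz
  rw [eq_div_iff (h z hz).1, (h z hz).2]

/-- A map commuting with an attracting linear fractional map fixing `0` is, near `0`, linear in the
linearizing coordinate `z / (1 - β * z)`. -/
theorem eventually_linear_of_commutes {Φ F : ℂ → ℂ} {α β : ℂ} (hα0 : α ≠ 0) (hα : ‖α‖ < 1)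
    (hΦ : ∀ z ∈ disk, (α - 1) * β * z + 1 ≠ 0 ∧ Φ z * ((α - 1) * β * z + 1) = α * z)
    (hF : IsSelfMap F) (hF0 : F 0 = 0) (hcomm : Commutes F Φ) :
    ∀ᶠ z in 𝓝 0, F z * (1 - β * z) = deriv F 0 * z * (1 - β * F z) := by
  have hFd : DifferentiableAt ℂ F 0 := hF.differentiableOn.differentiableAt disk_mem_nhds_zero
  have hFt : Tendsto F (𝓝 0) (𝓝 0) := by simpa [hF0] using hFd.continuousAt.tendsto
  have hlin : Tendsto (fun z : ℂ => 1 - β * z) (𝓝 0) (𝓝 1) := by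
    have : Continuous fun z : ℂ => 1 - β * z := by fun_prop
    simpa using this.tendsto 0
  -- `ψ z = σ (F z) / σ z` for `σ z = z / (1 - β * z)`. The hypothesis on `Φ` says `σ (Φ z) = α * σ
  -- z`, so commutation gives `ψ (Φ z) = ψ z`.
  set ψ : ℂ → ℂ := fun z => F z / z * ((1 - β * z) / (1 - β * F z)) with hψ
  have hψt : Tendsto ψ (𝓝[≠] 0) (𝓝 (deriv F 0)) := by
    have h1 : Tendsto (fun z => F z / z) (𝓝[≠] 0) (𝓝 (deriv F 0)) := by
      have := hasDerivAt_iff_tendsto_slope.1 hFd.hasDerivAt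
      simpa [slope_fun_def_field, hF0] using this
    have h2 := (hlin.div (hlin.comp hFt) one_ne_zero).mono_left
      (nhdsWithin_le_nhds (s := {(0 : ℂ)}ᶜ))
    simpa using h1.mul h2
  -- `q` serves as a contraction factor for `Φ` on a small ball, with room for the denominator to
  -- differ from `1`.
  obtain ⟨q, hq1, hq2⟩ := exists_between hα
  have hq0 : 0 ≤ q := (norm_nonneg α).trans hq1.le
  have hev : ∀ᶠ z : ℂ in 𝓝 0, z ∈ disk ∧ ‖α‖ < q * ‖(α - 1) * β * z + 1‖ ∧
      1 - β * z ≠ 0 ∧ 1 - β * F z ≠ 0 := by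
    refine (eventually_mem_set.2 disk_mem_nhds_zero).and (Eventually.and ?_ (Eventually.and ?_ ?_))
    · have : Continuous fun z : ℂ => q * ‖(α - 1) * β * z + 1‖ := by fun_prop
      refine (this.tendsto 0).eventually_const_lt ?_
      simpa using hq1
    · exact hlin.eventually_ne one_ne_zero
    · exact (hlin.comp hFt).eventually_ne one_ne_zero
  obtain ⟨r, hr, hball⟩ := Metric.eventually_nhds_iff_ball.1 hev
  filter_upwards [Metric.ball_mem_nhds (0 : ℂ) hr] with z hz
  rcases eq_or_ne z 0 with rfl | hz0
  · simp [hF0]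
  have hstep : ∀ w ∈ Metric.ball (0 : ℂ) r, ‖Φ w‖ ≤ q * ‖w‖ := by
    intro w hw
    obtain ⟨hwd, h1, -, -⟩ := hball w hw
    obtain ⟨h2, h3⟩ := hΦ w hwd
    have h4 := congrArg norm h3
    rw [norm_mul, norm_mul] at h4
    have h5 := norm_pos_iff.2 h2
    refine le_of_mul_le_mul_right ?_ h5
    rw [h4]
    nlinarith [norm_nonneg w]
  have hmem : ∀ w ∈ Metric.ball (0 : ℂ) r, Φ w ∈ Metric.ball (0 : ℂ) r := by
    intro w hw
    have h1 := hstep w hw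
    rw [mem_ball_zero_iff] at hw ⊢
    nlinarith [norm_nonneg w]
  have hne : ∀ w ∈ Metric.ball (0 : ℂ) r, w ≠ 0 → Φ w ≠ 0 := by
    intro w hw hw0 h0
    have h3 := (hΦ w (hball w hw).1).2
    rw [h0, zero_mul, eq_comm] at h3
    exact mul_ne_zero hα0 hw0 h3
  have hψinv : ∀ w ∈ Metric.ball (0 : ℂ) r, w ≠ 0 → ψ (Φ w) = ψ w := by
    intro w hw hw0
    obtain ⟨hwd, -, h1, h2⟩ := hball w hw
    obtain ⟨-, -, h1', h2'⟩ := hball _ (hmem w hw)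
    obtain ⟨h3, h4⟩ := hΦ w hwd
    obtain ⟨h5, h6⟩ := hΦ (F w) (hF.mapsTo hwd)
    have h7 := hne w hw hw0
    rw [hcomm w hwd] at h2'
    have h8 : Φ w * (1 - β * w) = α * w * (1 - β * Φ w) := by linear_combination h4
    have h9 : Φ (F w) * (1 - β * F w) = α * F w * (1 - β * Φ (F w)) := by linear_combination h6
    simp only [hψ]
    rw [hcomm w hwd, div_mul_div_comm, div_mul_div_comm,
      div_eq_div_iff (mul_ne_zero h7 h2') (mul_ne_zero hw0 h2)]
    apply mul_left_cancel₀ hα0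
    linear_combination (α * w * (1 - β * Φ w)) * h9 - (α * F w * (1 - β * Φ (F w))) * h8
  have hiter : ∀ n : ℕ, Φ^[n] z ∈ Metric.ball (0 : ℂ) r ∧ Φ^[n] z ≠ 0 ∧ ψ (Φ^[n] z) = ψ z ∧
      ‖Φ^[n] z‖ ≤ q ^ n * ‖z‖ := by
    intro n
    induction n with
    | zero => simpa [hz0] using hz
    | succ n ih =>
      obtain ⟨i1, i2, i3, i4⟩ := ih
      rw [Function.iterate_succ_apply']
      refine ⟨hmem _ i1, hne _ i1 i2, (hψinv _ i1 i2).trans i3, (hstep _ i1).trans ?_⟩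
      rw [pow_succ', mul_assoc]
      gcongr
  have hto : Tendsto (fun n => Φ^[n] z) atTop (𝓝[≠] 0) := by
    refine tendsto_nhdsWithin_iff.2 ⟨?_, .of_forall fun n => (hiter n).2.1⟩
    refine squeeze_zero_norm (fun n => (hiter n).2.2.2) ?_
    simpa using (tendsto_pow_atTop_nhds_zero_of_lt_one hq0 hq2).mul_const ‖z‖
  have hψz : ψ z = deriv F 0 := by
    refine tendsto_nhds_unique ?_ (hψt.comp hto)
    refine tendsto_const_nhds.congr fun n => ?_
    exact (hiter n).2.2.1.symm
  obtain ⟨-, -, h1, h2⟩ := hball z hz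
  rw [← hψz]
  simp only [hψ]
  rw [div_mul_div_comm, mul_assoc, div_mul_cancel₀ _ (mul_ne_zero hz0 h2)]

/-- Both maps have the form `z ↦ ε * z / ((ε - 1) * β * z + 1)` with the same `β`. For `ε ≠ 1` the
fixed points are `0` and `1 / β` (infinity if `β = 0`), whatever the multiplier `ε`. -/
theorem exists_isGivenBy_of_commutes_of_map_zero {Φ F : ℂ → ℂ} (hΦ : IsSelfMap Φ)
    (hΦ_lft : IsLFT Φ) (hΦ0 : Φ 0 = 0) (haut : ¬ IsAutomorphism Φ) (hF : IsSelfMap F)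
    (hF_const : ¬ IsConstant F) (hF_id : ¬ IsIdentity F) (hcomm : Commutes F Φ) :
    ∃ g k : GL (Fin 2) ℂ, IsGivenBy F g ∧ IsGivenBy Φ k ∧
      ∀ w : OnePoint ℂ, g • w = w ↔ k • w = w := by
  obtain ⟨k, hk⟩ := hΦ_lft
  rw [isGivenBy_iff] at hk
  have hdet := det_two_ne_zero k
  obtain ⟨hd, hb⟩ := hk 0 zero_mem_disk
  simp only [hΦ0, mul_zero, zero_add, zero_mul] at hd hb
  rw [← hb, zero_mul, sub_zero] at hdet
  set α := k 0 0 / k 1 1 with hα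
  have hα0 : α ≠ 0 := div_ne_zero (left_ne_zero_of_mul hdet) hd
  have hγ : ∀ z ∈ disk, k 1 0 / k 1 1 * z + 1 ≠ 0 ∧
      Φ z * (k 1 0 / k 1 1 * z + 1) = α * z := by
    intro z hz
    obtain ⟨h1, h2⟩ := hk z hz
    have h3 : k 1 0 / k 1 1 * z + 1 = (k 1 0 * z + k 1 1) / k 1 1 := by field_simp
    rw [h3]
    refine ⟨div_ne_zero h1 hd, ?_⟩
    rw [mul_div_assoc', h2, ← hb, hα]
    ring
  have hα1 : ‖α‖ < 1 := by
    have h := norm_dslope_lt_one hΦ hΦ0 haut zero_mem_disk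
    rwa [dslope_same, (hasDerivAt_of_mul_eq hγ).deriv] at h
  have hα1' : α - 1 ≠ 0 := by
    intro h
    rw [sub_eq_zero.1 h, norm_one] at hα1
    exact lt_irrefl _ hα1
  obtain ⟨β, hβ⟩ : ∃ β, k 1 0 / k 1 1 = (α - 1) * β :=
    ⟨k 1 0 / k 1 1 / (α - 1), by field_simp⟩
  rw [hβ] at hγ
  -- Commutation makes `F 0` a fixed point of `Φ`, and strict Schwarz leaves only `0`.
  have hF0 : F 0 = 0 := by
    by_contra h
    have h1 := norm_lt_of_not_isAutomorphism hΦ hΦ0 haut (hF.mapsTo zero_mem_disk) h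
    rw [← hcomm 0 zero_mem_disk, hΦ0] at h1
    exact lt_irrefl _ h1
  have hloc := eventually_linear_of_commutes hα0 hα1 hγ hF hF0 hcomm
  set δ := deriv F 0
  have hδ0 : δ ≠ 0 := by
    intro h
    have hne : ∀ᶠ z : ℂ in 𝓝 0, 1 - β * z ≠ 0 := by
      have : Continuous fun z : ℂ => 1 - β * z := by fun_prop
      exact this.continuousAt.eventually_ne (by simp)
    refine hF_const ⟨0, fun z hz => ?_⟩
    refine hF.analyticOnNhd.eqOn_zero_of_preconnected_of_eventuallyEq_zero isPreconnected_disk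
      zero_mem_disk ?_ hz
    filter_upwards [hloc, hne] with w hw hw1
    rw [h, zero_mul, zero_mul] at hw
    exact (mul_eq_zero.1 hw).resolve_right hw1
  have hglob : ∀ z ∈ disk, F z * ((δ - 1) * β * z + 1) = δ * z := by
    have hid : AnalyticOnNhd ℂ (fun z : ℂ => z) disk := fun z _ => analyticAt_id
    have h1 : AnalyticOnNhd ℂ (fun z => F z * ((δ - 1) * β * z + 1)) disk :=
      hF.analyticOnNhd.mul ((analyticOnNhd_const.mul hid).add analyticOnNhd_const)
    have h2 : AnalyticOnNhd ℂ (fun z => δ * z) disk := analyticOnNhd_const.mul hid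
    refine fun z hz => h1.eqOn_of_preconnected_of_eventuallyEq h2 isPreconnected_disk
      zero_mem_disk ?_ hz
    filter_upwards [hloc] with w hw
    linear_combination hw
  have hδ1 : δ - 1 ≠ 0 := by
    intro h
    refine hF_id fun z hz => ?_
    have := hglob z hz
    rw [h, sub_eq_zero.1 h] at this
    simpa using this
  refine ⟨mobius δ 0 ((δ - 1) * β) 1 (by simpa using hδ0),
    mobius α 0 ((α - 1) * β) 1 (by simpa using hα0), ?_, ?_, fun w => ?_⟩
  · rw [isGivenBy_iff]
    intro z hz
    simp only [mobius_one_zero, mobius_one_one, mobius_zero_zero, mobius_zero_one, add_zero]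
    -- A zero denominator would force `δ * z = 0`, so `z = 0`, where the denominator is `1`.
    refine ⟨fun h => ?_, hglob z hz⟩
    have := hglob z hz
    rw [h, mul_zero, eq_comm, mul_eq_zero] at this
    rw [this.resolve_left hδ0] at h
    simp at h
  · rw [isGivenBy_iff]
    simpa using hγ
  -- Both fixed-point sets are compared with that of multiplier `2`, an arbitrary choice other than
  -- `0` and `1`.
  · have key : ∀ ε : ℂ, ε - 1 ≠ 0 → ∀ hε, ((mobius ε 0 ((ε - 1) * β) 1 hε) • w = w ↔
        (mobius 2 0 β 1 (by simp)) • w = w) := by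
      intro ε hε1 hε
      cases w with
      | infty => simp [OnePoint.smul_infty_eq_self_iff, hε1]
      | coe w =>
        rw [smul_coe_eq_self_iff, smul_coe_eq_self_iff]
        simp only [mobius_one_zero, mobius_one_one, mobius_zero_zero, mobius_zero_one, sub_zero]
        rw [show (ε - 1) * β * w ^ 2 + (1 - ε) * w = (ε - 1) * (β * w ^ 2 + (1 - 2) * w) by ring,
          mul_eq_zero, or_iff_right hε1]
    rw [key δ hδ1, key α hα1']

theorem isLFT_of_commutes_of_isElliptic {φ f : ℂ → ℂ} (hφ : IsSelfMap φ) (hφ_lft : IsLFT φ)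
    {a : ℂ} (ha : a ∈ disk) (hfix : φ a = a) (haut : ¬ IsAutomorphism φ) (hf : IsSelfMap f)
    (hf_const : ¬ IsConstant f) (hf_id : ¬ IsIdentity f) (hcomm : Commutes f φ) :
    IsLFT f ∧ sphereFix f = sphereFix φ := by
  have hmem := (isSelfMap_invol ha).mapsTo
  obtain ⟨g, k, hg, hk, hgk⟩ := exists_isGivenBy_of_commutes_of_map_zero
    (Φ := involConj a φ) (F := involConj a f) (isSelfMap_involConj ha hφ)
    (isLFT_involConj ha hφ hφ_lft) (by simp [involConj, hfix])
    (fun h => haut (isAutomorphism_of_involConj ha hφ h)) (isSelfMap_involConj ha hf)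
    (fun ⟨c, hc⟩ => hf_const ⟨invol a c, fun z hz => by
      rw [← hc _ (hmem hz), involConj_invol ha hz, invol_invol ha (hf.mapsTo hz)]⟩)
    (fun h => hf_id fun z hz => by
      have := h _ (hmem hz)
      rw [involConj_invol ha hz] at this
      exact (bijOn_invol ha).injOn (hf.mapsTo hz) hz this)
    (fun z hz => by
      have h1 := hmem hz
      simp only [involConj, Function.comp_apply]
      rw [invol_invol ha (hφ.mapsTo h1), invol_invol ha (hf.mapsTo h1), hcomm _ h1])
  exact isLFT_and_sphereFix_eq (isGivenBy_of_involConj ha hf hg) (isGivenBy_of_involConj ha hφ hk)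
    hgk

/-! ### Rigidity of maps commuting with an affine map of the half-plane -/

/-- The open right half-plane. -/
abbrev halfPlane : Set ℂ := {w | 0 < w.re}

theorem isOpen_halfPlane : IsOpen halfPlane := isOpen_lt continuous_const Complex.continuous_re

/-- A map of the half-plane commuting with an invertible map `A` of the plane extends to the union
of all preimages of the half-plane under the iterates of `A`. -/
theorem exists_extension {A B F : ℂ → ℂ} (hA : Differentiable ℂ A) (hB : Differentiable ℂ B)
    (hAB : Function.RightInverse B A) (hBA : Function.LeftInverse B A)
    (hAm : Set.MapsTo A halfPlane halfPlane) (hF : DifferentiableOn ℂ F halfPlane)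
    (hcomm : ∀ w ∈ halfPlane, F (A w) = A (F w)) :
    ∃ G : ℂ → ℂ, (∀ n w, A^[n] w ∈ halfPlane → A^[n] (G w) = F (A^[n] w)) ∧
      (∀ n w, A^[n] w ∈ halfPlane → DifferentiableAt ℂ G w) ∧
      ∀ n w, A^[n] w ∈ halfPlane → G (A w) = A (G w) := by
  have hcommN : ∀ n, ∀ w ∈ halfPlane, F (A^[n] w) = A^[n] (F w) := by
    intro n
    induction n with
    | zero => simp
    | succ n ih =>
      intro w hw
      rw [Function.iterate_succ_apply, Function.iterate_succ_apply, ih _ (hAm hw), hcomm w hw]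
  have hex : ∀ w, ∃ v, ∀ n, A^[n] w ∈ halfPlane → A^[n] v = F (A^[n] w) := by
    intro w
    by_cases h : ∃ n, A^[n] w ∈ halfPlane
    · classical
      -- `A⁻ⁿ ∘ F ∘ Aⁿ` does not depend on the admissible `n`, by commutation; the least one is
      -- taken.
      refine ⟨B^[Nat.find h] (F (A^[Nat.find h] w)), fun n hn => ?_⟩
      obtain ⟨k, hk⟩ := Nat.exists_eq_add_of_le' (Nat.find_min' h hn)
      rw [hk, Function.iterate_add_apply, Function.iterate_add_apply, hAB.iterate _ _,
        hcommN k _ (Nat.find_spec h)]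
    -- Off the union of preimages the value is arbitrary.
    · exact ⟨0, fun n hn => absurd ⟨n, hn⟩ h⟩
  choose G hG using hex
  refine ⟨G, fun n w hn => hG w n hn, fun n w hn => ?_, fun n w hn => ?_⟩
  · have hopen : {w | A^[n] w ∈ halfPlane} ∈ 𝓝 w :=
      (isOpen_halfPlane.preimage (hA.iterate n).continuous).mem_nhds hn
    have hd : DifferentiableAt ℂ (fun w => B^[n] (F (A^[n] w))) w :=
      (hB.iterate n).differentiableAt.comp w
        ((hF.differentiableAt (isOpen_halfPlane.mem_nhds hn)).comp w
          (hA.iterate n).differentiableAt)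
    refine hd.congr_of_eventuallyEq ?_
    filter_upwards [hopen] with v hv
    rw [← hG v n hv, hBA.iterate n]
  · have h1 : A^[n] (A w) ∈ halfPlane := by
      rw [← Function.iterate_succ_apply, Function.iterate_succ_apply']
      exact hAm hn
    apply (hBA.injective.iterate n)
    rw [hG _ n h1, ← Function.iterate_succ_apply, ← Function.iterate_succ_apply,
      Function.iterate_succ_apply', Function.iterate_succ_apply', hcomm _ hn, hG _ n hn]

/-- A map of the half-plane commuting with a translation into its interior is a translation. -/
theorem eq_add_const_of_commutes_add {F : ℂ → ℂ} {b : ℂ} (hb : 0 < b.re)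
    (hF : DifferentiableOn ℂ F halfPlane) (hFm : Set.MapsTo F halfPlane halfPlane)
    (hcomm : ∀ w ∈ halfPlane, F (w + b) = F w + b) : ∃ c, ∀ w ∈ halfPlane, F w = w + c := by
  obtain ⟨G, hG1, hG2, hG3⟩ := exists_extension (A := fun w => w + b) (B := fun w => w - b)
    (by fun_prop) (by fun_prop) (fun w => sub_add_cancel w b) (fun w => add_sub_cancel_right w b)
    (fun w (hw : 0 < w.re) => show 0 < (w + b).re by rw [Complex.add_re]; positivity) hF hcomm
  have hit : ∀ (n : ℕ) (w : ℂ), (fun w => w + b)^[n] w = w + n * b := by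
    intro n w
    rw [add_right_iterate, nsmul_eq_mul]
  have hex : ∀ w : ℂ, ∃ n, (fun w => w + b)^[n] w ∈ halfPlane := by
    intro w
    obtain ⟨n, hn⟩ := exists_nat_gt (-w.re / b.re)
    rw [div_lt_iff₀ hb] at hn
    refine ⟨n, ?_⟩
    rw [hit]
    simp only [Set.mem_ofPred_eq, Complex.add_re, Complex.mul_re, Complex.natCast_re,
      Complex.natCast_im, zero_mul, sub_zero]
    linarith
  set P : ℂ → ℂ := fun w => G w - w with hP
  have hPd : Differentiable ℂ P := fun w =>
    (hG2 _ w (hex w).choose_spec).sub differentiableAt_id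
  have hPp : Function.Periodic P b := by
    intro w
    have := hG3 _ w (hex w).choose_spec
    simp only [hP, this]
    ring
  have hGF : ∀ w ∈ halfPlane, G w = F w := fun w hw => hG1 0 w hw
  -- Periodicity reduces to the strip `0 < w.re ≤ b.re`, where `G = F` has positive real part.
  have hPre : ∀ w, -b.re ≤ (P w).re := by
    intro w
    have h1 := toIocMod_mem_Ioc hb 0 w.re
    rw [← hPp.sub_zsmul_eq (toIocDiv hb 0 w.re)]
    have h2 : (w - toIocDiv hb 0 w.re • b).re = toIocMod hb 0 w.re := by
      rw [toIocMod, zsmul_eq_mul]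
      simp
    set v := w - toIocDiv hb 0 w.re • b
    rw [← h2, zero_add] at h1
    have h3 : 0 < (F v).re := hFm h1.1
    simp only [hP]
    rw [hGF v h1.1, Complex.sub_re]
    linarith [h1.2]
  -- The shift moves `P` into real part at least `1`, so its reciprocal is entire and bounded.
  have hge : ∀ w, 1 ≤ ‖P w + (b.re + 1 : ℝ)‖ := by
    intro w
    refine le_trans ?_ (Complex.re_le_norm _)
    rw [Complex.add_re, Complex.ofReal_re]
    linarith [hPre w]
  have hne : ∀ w, P w + (b.re + 1 : ℝ) ≠ 0 := fun w =>
    norm_pos_iff.1 (zero_lt_one.trans_le (hge w))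
  have hconst := Differentiable.apply_eq_apply_of_bounded
    (f := fun w => (P w + (b.re + 1 : ℝ))⁻¹) ((hPd.add_const _).inv hne) (by
      refine isBounded_iff_forall_norm_le.2 ⟨1, ?_⟩
      rintro _ ⟨w, rfl⟩
      simp only [norm_inv]
      exact inv_le_one_of_one_le₀ (hge w))
  refine ⟨P 0, fun w hw => ?_⟩
  have h1 : P w = P 0 := add_right_cancel (inv_injective (hconst w 0))
  rw [← h1, ← hGF w hw]
  simp [hP]

/-- A map of the half-plane commuting with a dilation is a dilation. -/
theorem eq_const_mul_of_commutes_mul {K : ℂ → ℂ} {l : ℝ} (hl : 1 < l)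
    (hK : DifferentiableOn ℂ K halfPlane) (hKm : Set.MapsTo K halfPlane halfPlane)
    (hcomm : K l = l * K 1) : ∃ m : ℂ, m ≠ 0 ∧ ∀ w ∈ halfPlane, K w = m * w := by
  set ζ := K 1 with hζ
  have hζre : 0 < ζ.re := hKm (show (0 : ℝ) < (1 : ℂ).re by simp)
  have hζ0 : ζ ≠ 0 := by
    intro h
    simp [h] at hζre
  have hne : ∀ w ∈ halfPlane, w + conj ζ ≠ 0 := by
    intro w hw h
    have := congrArg Complex.re h
    have hw' : 0 < w.re := hw
    simp at this
    linarith
  have h11 : ‖(1 : ℂ)‖ = 1 := norm_one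
  have hcay : ∀ x ∈ disk, cayley 1 x ∈ halfPlane := fun x hx => re_cayley_pos h11 hx
  -- `K` read between disk coordinates centred at `1` and at `ζ = K 1`, so that `E 0 = 0` and
  -- Schwarz's lemma applies.
  set E : ℂ → ℂ := fun x => (K (cayley 1 x) - ζ) / (K (cayley 1 x) + conj ζ) with hE
  have hEs : IsSelfMap E := by
    have hd : DifferentiableOn ℂ (fun x => K (cayley 1 x)) disk :=
      hK.comp (differentiableOn_cayley h11) hcay
    refine ⟨(hd.sub_const _).div (hd.add_const _) fun x hx => hne _ (hKm (hcay x hx)),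
      fun x hx => ?_⟩
    have h1 : 0 < (K (cayley 1 x)).re := hKm (hcay x hx)
    rw [mem_disk_iff, norm_div, div_lt_one (norm_pos_iff.2 (hne _ h1)),
      ← sq_lt_sq₀ (norm_nonneg _) (norm_nonneg _), ← Complex.normSq_eq_norm_sq,
      ← Complex.normSq_eq_norm_sq, Complex.normSq_apply, Complex.normSq_apply]
    simp only [Complex.sub_re, Complex.sub_im, Complex.add_re, Complex.add_im, Complex.conj_re,
      Complex.conj_im]
    nlinarith
  have hE0 : E 0 = 0 := by simp [hE, cayley, hζ]
  have hmaps : Set.MapsTo E (Metric.ball 0 1) (Metric.closedBall (E 0) 1) := by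
    rw [hE0]
    exact hEs.mapsTo.mono_right Metric.ball_subset_closedBall
  have hl0 : 0 < (l : ℂ).re := by
    rw [Complex.ofReal_re]
    linarith
  set x₀ := cayleyInv 1 l with hx₀
  have hx₀d : x₀ ∈ disk := cayleyInv_mem_disk h11 hl0
  have hcx₀ : cayley 1 x₀ = l := cayley_cayleyInv h11 hl0.le
  have hl1 : (l : ℂ) + 1 ≠ 0 := add_one_ne_zero_of_re_nonneg hl0.le
  have hl2 : (l : ℂ) - 1 ≠ 0 := by exact_mod_cast (sub_pos.2 hl).ne'
  have hx₀0 : x₀ ≠ 0 := by simp [hx₀, cayleyInv, hl1, hl2]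
  have hden : l * ζ + conj ζ ≠ 0 := by
    have := hne _ (hKm hl0)
    rwa [hcomm] at this
  have hslope : dslope E 0 x₀ = (l + 1) * ζ / (l * ζ + conj ζ) := by
    rw [dslope_of_ne _ hx₀0, slope_def_field, hE0, sub_zero, sub_zero]
    simp only [hE]
    rw [hcx₀, hcomm, hx₀, cayleyInv, one_mul]
    field_simp
  have hle : ‖dslope E 0 x₀‖ ≤ 1 := by
    simpa using Complex.norm_dslope_le_div_of_mapsTo_ball hEs.differentiableOn hmaps hx₀d
  -- The hyperbolic distance from `ζ` to `l * ζ` is at least that from `1` to `l`, with equality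
  -- only for real `ζ`. Contraction thus forces `ζ` real and then equality, so `E` is the identity.
  have him : ζ.im = 0 := by
    rw [hslope, norm_div, div_le_one (norm_pos_iff.2 hden),
      ← sq_le_sq₀ (norm_nonneg _) (norm_nonneg _), ← Complex.normSq_eq_norm_sq,
      ← Complex.normSq_eq_norm_sq, Complex.normSq_apply, Complex.normSq_apply] at hle
    simp at hle
    have : 4 * l * ζ.im ^ 2 ≤ 0 := by linarith
    have h3 : ζ.im ^ 2 ≤ 0 := by
      by_contra! h4
      have := mul_pos (by linarith : 0 < 4 * l) h4
      linarith
    exact pow_eq_zero_iff two_ne_zero |>.1 (le_antisymm h3 (sq_nonneg _))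
  have hconj : conj ζ = ζ := Complex.conj_eq_iff_im.2 him
  have hslope1 : dslope E 0 x₀ = 1 := by
    rw [hslope, hconj, div_eq_one_iff_eq (by rwa [hconj] at hden)]
    ring
  have haff := Complex.affine_of_mapsTo_ball_of_norm_dslope_eq_div hEs.differentiableOn hmaps
    hx₀d (by rw [hslope1]; simp)
  refine ⟨ζ, hζ0, fun w hw => ?_⟩
  have hw' : 0 < w.re := hw
  have h1 := haff (cayleyInv_mem_disk h11 hw')
  have h2 := hne _ (hKm hw)
  have h3 := add_one_ne_zero_of_re_nonneg hw'.le
  simp only [hE0, hslope1, zero_add, sub_zero, smul_eq_mul, mul_one] at h1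
  simp only [hE] at h1
  rw [cayley_cayleyInv h11 hw'.le, cayleyInv, one_mul, div_eq_div_iff h2 h3, hconj] at h1
  apply mul_left_cancel₀ (two_ne_zero (α := ℂ))
  linear_combination h1

/-- A map of the half-plane commuting with an expanding affine map is affine, with the same fixed
point. -/
theorem eq_affine_of_commutes_affine {F : ℂ → ℂ} {q : ℂ} {l : ℝ} (hl : 1 < l) (hq : q.re ≤ 0)
    (hF : DifferentiableOn ℂ F halfPlane) (hFm : Set.MapsTo F halfPlane halfPlane)
    (hcomm : ∀ w ∈ halfPlane, F (l * (w - q) + q) = l * (F w - q) + q) :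
    ∃ m : ℂ, m ≠ 0 ∧ ∀ w ∈ halfPlane, F w = m * (w - q) + q := by
  have hl0 : (l : ℂ) ≠ 0 := by exact_mod_cast (zero_lt_one.trans hl).ne'
  have hre : ∀ (c : ℝ) (w : ℂ), (c * (w - q) + q).re = c * (w - q).re + q.re := by
    intro c w
    rw [Complex.add_re, Complex.re_ofReal_mul]
  obtain ⟨G, hG1, hG2, hG3⟩ := exists_extension (A := fun w => l * (w - q) + q)
    (B := fun w => (w - q) / l + q) (by fun_prop) (by fun_prop)
    (fun w => by simp only [add_sub_cancel_right]; field_simp; ring)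
    (fun w => by simp only [add_sub_cancel_right]; field_simp; ring)
    (fun w (hw : 0 < w.re) => by
      rw [Set.mem_ofPred_eq, hre, Complex.sub_re]
      nlinarith) hF hcomm
  have hit : ∀ (n : ℕ) (w : ℂ), (fun w => l * (w - q) + q)^[n] w = (l ^ n : ℝ) * (w - q) + q := by
    intro n w
    induction n with
    | zero => simp
    | succ n ih =>
      rw [Function.iterate_succ_apply', ih]
      push_cast
      ring
  -- The extension is defined on all of `q.re < w.re`: the expansion about `q` pushes such points
  -- into the half-plane.
  have hex : ∀ v ∈ halfPlane, ∃ n, (fun w => l * (w - q) + q)^[n] (v + q) ∈ halfPlane := by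
    intro v hv
    have hv' : 0 < v.re := hv
    obtain ⟨n, hn⟩ := pow_unbounded_of_one_lt (-q.re / v.re) hl
    rw [div_lt_iff₀ hv'] at hn
    refine ⟨n, ?_⟩
    rw [hit, Set.mem_ofPred_eq, hre, add_sub_cancel_right]
    linarith
  -- Translating `q` to `0` turns the affine map into the dilation by `l`.
  obtain ⟨m, hm, hKm⟩ := eq_const_mul_of_commutes_mul (K := fun v => G (v + q) - q) hl
    (fun v hv => by
      obtain ⟨n, hn⟩ := hex v hv
      have h1 : DifferentiableAt ℂ (fun v => G (v + q)) v :=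
        (hG2 n (v + q) hn).comp v (by fun_prop : DifferentiableAt ℂ (fun v => v + q) v)
      exact (h1.sub_const q).differentiableWithinAt)
    (fun v hv => by
      obtain ⟨n, hn⟩ := hex v hv
      have h1 : (0 : ℝ) < (F _).re := hFm hn
      rw [← hG1 n _ hn, hit, hre] at h1
      have h2 : 0 < l ^ n := pow_pos (zero_lt_one.trans hl) n
      exact pos_of_mul_pos_right (by linarith) h2.le)
    (by
      obtain ⟨n, hn⟩ := hex 1 (show (0 : ℝ) < (1 : ℂ).re by simp)
      have h1 := hG3 n _ hn
      simp only [add_sub_cancel_right, mul_one] at h1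
      simp only [h1]
      ring)
  refine ⟨m, hm, fun w hw => ?_⟩
  have hw' : 0 < w.re := hw
  have h1 := hKm (w - q) (by
    rw [Set.mem_ofPred_eq, Complex.sub_re]
    linarith)
  simp only [sub_add_cancel] at h1
  have h2 : G w = F w := hG1 0 w hw
  rw [← h1, h2]
  ring

/-! ### No fixed point in the disk: transfer to the half-plane -/

/-- A self-map in the half-plane coordinate given by the Cayley transform. -/
noncomputable def cayleyConj (p : ℂ) (f : ℂ → ℂ) : ℂ → ℂ := fun w => cayley p (f (cayleyInv p w))

section cayleyConj
variable {f φ : ℂ → ℂ} {p l b : ℂ}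

theorem differentiableOn_cayleyConj (hf : IsSelfMap f) (hp : ‖p‖ = 1) :
    DifferentiableOn ℂ (cayleyConj p f) halfPlane :=
  (differentiableOn_cayley hp).comp (hf.differentiableOn.comp differentiableOn_cayleyInv
    fun _ hw => cayleyInv_mem_disk hp hw) fun _ hw => hf.mapsTo (cayleyInv_mem_disk hp hw)

theorem mapsTo_cayleyConj (hf : IsSelfMap f) (hp : ‖p‖ = 1) :
    Set.MapsTo (cayleyConj p f) halfPlane halfPlane := fun _ hw =>
  re_cayley_pos hp (hf.mapsTo (cayleyInv_mem_disk hp hw))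

theorem IsAffineAt.cayleyConj_comm (h : IsAffineAt φ p l b) (hφ : IsSelfMap φ) (hf : IsSelfMap f)
    (hp : ‖p‖ = 1) (hcomm : Commutes f φ) {w : ℂ} (hw : w ∈ halfPlane) :
    cayleyConj p f (l * w + b) = l * cayleyConj p f w + b := by
  have hz := cayleyInv_mem_disk hp hw
  have h1 := h _ hz
  rw [cayley_cayleyInv hp (le_of_lt hw)] at h1
  rw [cayleyConj, ← h1, cayleyInv_cayley hp (hφ.mapsTo hz), hcomm _ hz, h _ (hf.mapsTo hz)]
  rfl

theorem isAffineAt_of_cayleyConj (hp : ‖p‖ = 1)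
    (h : ∀ w ∈ halfPlane, cayleyConj p f w = l * w + b) : IsAffineAt f p l b := fun z hz => by
  rw [← h _ (re_cayley_pos hp hz), cayleyConj, cayleyInv_cayley hp hz]

theorem IsAffineAt.isIdentity (h : IsAffineAt f p 1 0) (hf : IsSelfMap f) (hp : ‖p‖ = 1) :
    IsIdentity f := fun z hz => cayley_injOn hp (hf.mapsTo hz) hz (by simpa using h z hz)

theorem IsAffineAt.isAutomorphism (h : IsAffineAt φ p 1 b) (hφ : IsSelfMap φ) (hp : ‖p‖ = 1)
    (hb : b.re = 0) : IsAutomorphism φ := by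
  have hre : ∀ z ∈ disk, 0 < (cayley p z - b).re := fun z hz => by
    rw [Complex.sub_re, hb, sub_zero]
    exact re_cayley_pos hp hz
  refine Set.InvOn.bijOn (f' := fun z => cayleyInv p (cayley p z - b)) ⟨fun z hz => ?_,
    fun z hz => ?_⟩ hφ.mapsTo fun z hz => cayleyInv_mem_disk hp (hre z hz)
  · simp only [h z hz, one_mul, add_sub_cancel_right, cayleyInv_cayley hp hz]
  · have hz' := cayleyInv_mem_disk hp (hre z hz)
    refine cayley_injOn hp (hφ.mapsTo hz') hz ?_
    rw [h _ hz', cayley_cayleyInv hp (hre z hz).le, one_mul, sub_add_cancel]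

theorem isLFT_of_commutes_of_forall_ne (hφ : IsSelfMap φ) (hφ_lft : IsLFT φ)
    (hfix : ∀ z ∈ disk, φ z ≠ z) (hφ_par : ¬ (IsParabolic φ ∧ IsAutomorphism φ))
    (hf : IsSelfMap f) (hf_id : ¬ IsIdentity f) (hcomm : Commutes f φ) :
    IsLFT f ∧ sphereFix f = sphereFix φ := by
  obtain ⟨p, b, l, hp, hl, hb, hlb, h⟩ := exists_isAffineAt_one_le hφ hφ_lft hfix
  have hl0 : (l : ℂ) ≠ 0 := by exact_mod_cast (zero_lt_one.trans_le hl).ne'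
  have hFd := differentiableOn_cayleyConj hf hp
  have hFm := mapsTo_cayleyConj hf hp
  have hFc := fun w hw => h.cayleyConj_comm hφ hf hp hcomm (w := w) hw
  rcases hl.eq_or_lt with rfl | hl
  · have hb0 := hlb rfl
    rw [Complex.ofReal_one] at h
    -- A purely imaginary translation would be an excluded parabolic automorphism.
    have hbre : 0 < b.re := by
      refine lt_of_le_of_ne hb fun h0 => hφ_par ⟨h.isParabolic hφ hfix hp hb hb0, ?_⟩
      exact h.isAutomorphism hφ hp h0.symm
    obtain ⟨c, hc⟩ := eq_add_const_of_commutes_add hbre hFd hFm (by simpa using hFc)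
    have h' : IsAffineAt f p 1 c := isAffineAt_of_cayleyConj hp (by simpa using hc)
    have hc0 : c ≠ 0 := by
      rintro rfl
      exact hf_id (h'.isIdentity hf hp)
    exact h.isLFT_and_sphereFix_eq h' hφ hf hp one_ne_zero one_ne_zero (by simp [hb0, hc0])
  · have hl1 : (1 - l : ℂ) ≠ 0 := by exact_mod_cast (sub_neg.2 hl).ne
    -- `q` is the finite fixed point; `0 ≤ b.re` and `1 < l` put it at `q.re ≤ 0`.
    obtain ⟨q, hq⟩ : ∃ q : ℂ, b = (1 - l) * q := ⟨b / (1 - l), by field_simp⟩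
    have hqre : q.re ≤ 0 := by
      have : b.re = (1 - l) * q.re := by
        rw [hq]
        simp
      nlinarith
    obtain ⟨m, hm, hmF⟩ := eq_affine_of_commutes_affine (q := q) hl hqre hFd hFm fun w hw => by
      have := hFc w hw
      rw [hq] at this
      rw [show l * (w - q) + q = l * w + (1 - l) * q by ring, this]
      ring
    have h' : IsAffineAt f p m ((1 - m) * q) := isAffineAt_of_cayleyConj hp fun w hw => by
      rw [hmF w hw]
      ring
    have hm1 : 1 - m ≠ 0 := by
      intro h1
      rw [h1, zero_mul, ← sub_eq_zero.1 h1] at h'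
      exact hf_id (h'.isIdentity hf hp)
    refine h.isLFT_and_sphereFix_eq h' hφ hf hp hl0 hm fun w => ?_
    have key : ∀ k : ℂ, 1 - k ≠ 0 → (k * w + (1 - k) * q = w ↔ w = q) := fun k hk => by
      rw [← sub_eq_zero, show k * w + (1 - k) * q - w = (1 - k) * (q - w) by ring, mul_eq_zero,
        or_iff_right hk, sub_eq_zero, eq_comm]
    rw [hq, key m hm1, key l hl1]

end cayleyConj

end DiskMap

theorem mainTheorem2 (φ f : ℂ → ℂ)
    (hφ : DiskMap.IsSelfMap φ) (hφ_lft : DiskMap.IsLFT φ)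
    (hφ_id : ¬ DiskMap.IsIdentity φ)
    (hφ_ell : ¬ (DiskMap.IsElliptic φ ∧ DiskMap.IsAutomorphism φ))
    (hφ_par : ¬ (DiskMap.IsParabolic φ ∧ DiskMap.IsAutomorphism φ))
    (hf : DiskMap.IsSelfMap f)
    (hf_const : ¬ DiskMap.IsConstant f) (hf_id : ¬ DiskMap.IsIdentity f) :
    (DiskMap.Commutes f φ ↔
      DiskMap.IsLFT f ∧ DiskMap.sphereFix f = DiskMap.sphereFix φ) ∧
    (DiskMap.Commutes f φ →
      ∃ t : DiskMap.DynamicType, DiskMap.HasType φ t ∧ DiskMap.HasType f t) := by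
  have forward : DiskMap.Commutes f φ →
      DiskMap.IsLFT f ∧ DiskMap.sphereFix f = DiskMap.sphereFix φ := by
    intro hcomm
    by_cases hfix : ∀ z ∈ DiskMap.disk, φ z ≠ z
    · exact DiskMap.isLFT_of_commutes_of_forall_ne hφ hφ_lft hfix hφ_par hf hf_id hcomm
    · push Not at hfix
      obtain ⟨a, ha, h⟩ := hfix
      exact DiskMap.isLFT_of_commutes_of_isElliptic hφ hφ_lft ha h
        (fun haut => hφ_ell ⟨⟨hφ_id, a, ha, h⟩, haut⟩) hf hf_const hf_id hcomm
  refine ⟨⟨forward, fun h => ?_⟩, fun hcomm => ?_⟩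
  · exact DiskMap.commutes_of_sphereFix_eq hf hφ h.1 hφ_lft h.2
  · obtain ⟨hf_lft, h⟩ := forward hcomm
    exact DiskMap.exists_hasType_of_sphereFix_eq hf hφ hf_lft hφ_lft hf_id hφ_id h
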